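/- Let $M$ be a connected Riemannian manifold of dimension $n$ (smooth, Hausdorff), let $p\ge 1$, and let $\varphi\in\Omega^p(M)$ be a nonzero parallel calibration, i.e. a smooth $p$-form, parallel for the Levi-Civita connection (hence closed), with $\varphi(e_1,\dots,e_p)\le 1$ for all orthonormal $e_1,\dots,e_p\in T_xM$, and $\varphi\not\equiv 0$. Let $\mathscr P\subset\Omega^p(M)$ be the space of smooth $p$-forms $\psi$ such that for every $x\in M$ there is $\theta\in\mathfrak o(T_xM)$ with $\psi_x=\theta.\varphi_x$, where $(\theta.\varphi_x)(v_1,\dots,v_p)=\sum_a\varphi_x(v_1,\dots,\theta v_a,\dots,v_p)$, and let $\mathscr I\subset\Omega(M)$ be the ideal algebraically generated by $\mathscr P$, with $\mathscr I^k=\mathscr I\cap\Omega^k(M)$. Let $\mathscr V_k(\mathscr I)\subset \mathrm{Gr}(k,TM)$ be the set of $k$-dimensional integral elements of $\mathscr I$ (the $k$-planes to which all forms in $\mathscr I$ restrict to zero), and for $E\in\mathscr V_k(\mathscr I)$, $E\subset T_xM$, let $H(E)=\{v\in T_xM : \psi(v,e_1,\dots,e_k)=0\ \ \forall\,\psi\in\mathscr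 I^{k+1},\ e_1,\dots,e_k\in E\}$ be its polar space. A subset of $\mathrm{Gr}(p,TM)$ has codimension at least $c$ at one of its points $E$ if near $E$ it is contained in a smooth submanifold of codimension $c$ through $E$. An integral element $E\in \mathscr V_k(\mathscr I)$ is Kähler-ordinary if near $E$ the set $\mathscr V_k(\mathscr I)$ is the common zero set in $\mathrm{Gr}(k,TM)$ of finitely many of the functions defined by forms in $\mathscr I^k$, with differentials linearly independent at $E$; it is Kähler-regular if moreover $\dim H$ is constant on the Kähler-ordinary elements near $E$. A $p$-dimensional integral element $E$ is ordinary if it has a flag $0=E_0\subset E_1\subset\dots\subset E_p=E$, $\dim E_k=k$, with $E_k$ Kähler-regular for all $k<p$. The system $\mathscr I$ is involutive at $x$ if there is an ordinary $p$-dimensional integral element $E\subset T_xM$. (1) Let $E\in\mathscr V_p(\mathscr I)$ have nonzero critical value, i.e. $\varphi(e_1,\dots,e_p)\ne0$ for an orthonormal basis of $E$. Then for every complete flag $0=E_0\subset\dots\subset E_p=E$ the sum of the codimensions $\sum_{k<p}\mathrm{codim}\,H(E_k)$ (the bound in Cartan's test) equals $n-p$, and $\mathscr V_p(\mathscr I)$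 has codimension at least $n-p$ at $E$ in $\mathrm{Gr}(p,TM)$. If $p<n$, then $\mathscr V_p(\mathscr I)$ also has codimension at least $p$ at $E$; in particular, equality fails in the bound $\mathrm{codim}_E\mathscr V_p(\mathscr I)\ge n-p$ when $\tfrac n2<p<n$. (2) If $\tfrac n2<p<n$, then $\mathscr I$ is not involutive: at no point $x\in M$ is it involutive. (So $\mathscr I$ is in general not involutive.) -/

import Mathlib

open scoped Manifold ContDiff Topology Bundle

noncomputable section

namespace EDS

/-- The model space `ℝⁿ`. -/
abbrev Model (n : ℕ) : Type := EuclideanSpace ℝ (Fin n)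

/-- The tangent space `T_x M`. -/
abbrev Tan (n : ℕ) {M : Type*} [TopologicalSpace M] [ChartedSpace (Model n) M] (x : M) : Type :=
  TangentSpace (𝓡 n) x

/-- (Not necessarily smooth) differential `k`-forms on `M`. -/
abbrev Form (n : ℕ) (M : Type*) [TopologicalSpace M] [ChartedSpace (Model n) M] (k : ℕ) : Type _ :=
  ∀ x : M, (Tan n x) [⋀^Fin k]→ₗ[ℝ] ℝ

/-- A pair `(x, E)` of a point `x ∈ M` and a linear subspace `E ⊆ T_x M`.  Those with `dim E = k`
are the points of the Grassmann bundle `Gr(k, TM)`. -/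
abbrev TangentPlane (n : ℕ) (M : Type*) [TopologicalSpace M] [ChartedSpace (Model n) M] : Type _ :=
  Σ x : M, Submodule ℝ (Tan n x)

section Manifold

variable {n : ℕ} {M : Type*} [TopologicalSpace M] [ChartedSpace (Model n) M]
  [IsManifold (𝓡 n) ∞ M]

/-- The vector field `Y` is smooth at `x`. -/
def SmoothFieldAt (Y : ∀ z : M, Tan n z) (x : M) : Prop :=
  ContMDiffAt (𝓡 n) ((𝓡 n).prod 𝓘(ℝ, Model n)) ∞ (fun z => (⟨z, Y z⟩ : TangentBundle (𝓡 n) M)) x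

/-- The vector field `Y` is differentiable at `x`. -/
def DifferentiableFieldAt (Y : ∀ z : M, Tan n z) (x : M) : Prop :=
  MDifferentiableAt (𝓡 n) ((𝓡 n).prod 𝓘(ℝ, Model n))
    (fun z => (⟨z, Y z⟩ : TangentBundle (𝓡 n) M)) x

/-- `φ ∈ Ω^k(M)`: a form is smooth if its values on smooth vector fields are smooth. -/
def IsSmoothForm {k : ℕ} (φ : Form n M k) : Prop :=
  ∀ (x : M) (Y : Fin k → ∀ z : M, Tan n z), (∀ a, SmoothFieldAt (Y a) x) →
    ContMDiffAt (𝓡 n) 𝓘(ℝ, ℝ) ∞ (fun z => φ z (fun a => Y a z)) x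

/-- The exterior product `α ∧ β`. -/
def wedge {V : Type*} [AddCommGroup V] [Module ℝ V] {j k : ℕ}
    (α : V [⋀^Fin j]→ₗ[ℝ] ℝ) (β : V [⋀^Fin k]→ₗ[ℝ] ℝ) : V [⋀^Fin (j + k)]→ₗ[ℝ] ℝ :=
  ((LinearMap.mul' ℝ ℝ).compAlternatingMap (α.domCoprod β)).domDomCongr finSumFinEquiv

/-- The degree `k` part `𝓘^k` of the ideal `𝓘 ⊆ Ω(M)` algebraically generated by a set `P` of
`p`-forms: finite sums of products `α ∧ ψ` with `ψ ∈ P` and `α ∈ Ω^{k-p}(M)`. -/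
def idealGeneratedBy {p : ℕ} (P : Set (Form n M p)) (k : ℕ) : Submodule ℝ (Form n M k) :=
  Submodule.span ℝ {χ | ∃ (j : ℕ) (h : j + p = k) (α : Form n M j) (ψ : Form n M p),
    IsSmoothForm α ∧ ψ ∈ P ∧ ∀ x, χ x = (wedge (α x) (ψ x)).domDomCongr (finCongr h)}

/-! ### The Grassmann bundle -/

/-- The differential at `y` of the inverse of the preferred chart at `x₀`, as a map from `ℝⁿ` to
the tangent space of `M` at the point `z` with coordinates `y`. -/
def chartDeriv (x₀ z : M) : Model n →L[ℝ] Tan n z :=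
  (trivializationAt (Model n) (TangentSpace (𝓡 n) : M → Type) x₀).symmL ℝ z

/-- The data of a standard affine chart of `Gr(k, TM)` centred at `E ⊆ T_{x₀} M`: in the preferred
coordinates of `M` at `x₀`, a basis of `E` and a linear complement of `E`. -/
structure GrChart (k : ℕ) (E : TangentPlane n M) where
  frame : Fin k → Model n
  compl : Submodule ℝ (Model n)
  linearIndependent : LinearIndependent ℝ frame
  span_eq : Submodule.span ℝ (Set.range fun a => chartDeriv E.1 E.1 (frame a)) = E.2
  isCompl : IsCompl (Submodule.span ℝ (Set.range frame)) compl

namespace GrChart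

variable {k : ℕ} {E : TangentPlane n M}

/-- The coordinate space of the chart.  Its dimension is `n + k (n - k) = dim Gr(k, TM)`. -/
abbrev Coord (κ : GrChart k E) : Type := Model n × (Fin k → κ.compl)

/-- The coordinates of `E` itself. -/
def center (κ : GrChart k E) : κ.Coord := (extChartAt (𝓡 n) E.1 E.1, 0)

/-- The base point of the plane with coordinates `q`. -/
def point (κ : GrChart k E) (q : κ.Coord) : M := (extChartAt (𝓡 n) E.1).symm q.1

/-- The basis `e_a + A_a` of the plane with coordinates `q = (y, A)`. -/
def basis (κ : GrChart k E) (q : κ.Coord) : Fin k → Tan n (κ.point q) :=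
  fun a => chartDeriv E.1 (κ.point q) (κ.frame a + (q.2 a : Model n))

/-- The plane with coordinates `q`; for `q` near `κ.center` this is a diffeomorphism onto a
neighbourhood of `E` in `Gr(k, TM)`. -/
def plane (κ : GrChart k E) (q : κ.Coord) : TangentPlane n M :=
  ⟨κ.point q, Submodule.span ℝ (Set.range (κ.basis q))⟩

end GrChart

/-- The subset `X` of `Gr(k, TM)` has codimension at least `c` at `E`: near `E` it is contained in
a smooth submanifold of codimension `c` through `E`, i.e. in the zero set of a smooth `ℝᶜ`-valued
function which vanishes at `E` and has surjective differential there. -/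
def HasCodimAtLeast (k : ℕ) (X : Set (TangentPlane n M)) (E : TangentPlane n M) (c : ℕ) : Prop :=
  ∃ (κ : GrChart k E) (U : Set κ.Coord) (f : κ.Coord → (Fin c → ℝ)),
    U ∈ 𝓝 κ.center ∧ ContDiffOn ℝ ∞ f U ∧ f κ.center = 0 ∧
    Function.Surjective (fderiv ℝ f κ.center) ∧ ∀ q ∈ U, κ.plane q ∈ X → f q = 0

/-! ### Integral elements, polar spaces, involutivity

Here `J` is a homogeneous ideal of differential forms, given by its degree `k` parts `J k`. -/

variable (J : ∀ k : ℕ, Submodule ℝ (Form n M k))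

/-- `𝓥_k(J) ⊆ Gr(k, TM)`: the `k`-dimensional integral elements, i.e. the `k`-planes to which
every form in `J` restricts to zero. -/
def integralElements (k : ℕ) : Set (TangentPlane n M) :=
  {E | Module.finrank ℝ E.2 = k ∧
    ∀ (j : ℕ), ∀ ψ ∈ J j, ∀ v : Fin j → Tan n E.1, (∀ i, v i ∈ E.2) → ψ E.1 v = 0}

/-- The polar space `H(E)` of a `k`-dimensional integral element: all `v` with
`ψ(v, e₁, …, e_k) = 0` for all `ψ ∈ J^{k+1}` and `e₁, …, e_k ∈ E`. -/
def polarSpace (k : ℕ) (E : TangentPlane n M) : Submodule ℝ (Tan n E.1) where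
  carrier := {v | ∀ ψ ∈ J (k + 1), ∀ e : Fin k → Tan n E.1, (∀ i, e i ∈ E.2) →
    ψ E.1 (Matrix.vecCons v e) = 0}
  zero_mem' := fun ψ _ e _ => (ψ E.1).map_coord_zero 0 (by simp)
  add_mem' := fun {v w} hv hw ψ hψ e he => by
    rw [AlternatingMap.map_vecCons_add, hv ψ hψ e he, hw ψ hψ e he, add_zero]
  smul_mem' := fun c v hv ψ hψ e he => by
    rw [AlternatingMap.map_vecCons_smul, hv ψ hψ e he, smul_zero]

/-- `E` is a Kähler-ordinary `k`-dimensional integral element: near `E`, the set `𝓥_k(J)` is cut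
out in `Gr(k, TM)` by finitely many of the functions `E' ↦ ψ(E')`, `ψ ∈ J^k`, whose differentials
at `E` are linearly independent.  (A form `ψ` is made into a function by evaluating it on the basis
of `E'` given by the chart; other normalizations differ by a nowhere zero smooth factor.) -/
def IsKahlerOrdinary (k : ℕ) (E : TangentPlane n M) : Prop :=
  E ∈ integralElements J k ∧
  ∃ (κ : GrChart k E) (m : ℕ) (ψ : Fin m → Form n M k), (∀ i, ψ i ∈ J k) ∧
    LinearIndependent ℝ
      (fun i => fderiv ℝ (fun q : κ.Coord => ψ i (κ.point q) (κ.basis q)) κ.center) ∧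
    ∀ᶠ q in 𝓝 κ.center, (∀ i, ψ i (κ.point q) (κ.basis q) = 0) →
      ∀ χ ∈ J k, χ (κ.point q) (κ.basis q) = 0

/-- `E` is a Kähler-regular `k`-dimensional integral element: it is Kähler-ordinary, and the
dimension of the polar space is constant on the Kähler-ordinary elements near `E`. -/
def IsKahlerRegular (k : ℕ) (E : TangentPlane n M) : Prop :=
  IsKahlerOrdinary J k E ∧
  ∃ κ : GrChart k E, ∀ᶠ q in 𝓝 κ.center, IsKahlerOrdinary J k (κ.plane q) →
    Module.finrank ℝ (polarSpace J k (κ.plane q)) = Module.finrank ℝ (polarSpace J k E)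

/-- `F 0 ⊂ F 1 ⊂ ⋯ ⊂ F p = E` is a complete flag of the `p`-plane `E`. -/
structure IsFlag (p : ℕ) (E : TangentPlane n M) (F : ℕ → Submodule ℝ (Tan n E.1)) : Prop where
  le_succ : ∀ k < p, F k ≤ F (k + 1)
  finrank_eq : ∀ k ≤ p, Module.finrank ℝ (F k) = k
  top_eq : F p = E.2

/-- `E` is an ordinary `p`-dimensional integral element: the last member of a flag
`0 = E₀ ⊂ E₁ ⊂ ⋯ ⊂ E_p = E` of integral elements such that `E_k` is Kähler-regular for `k < p`. -/
def IsOrdinary (p : ℕ) (E : TangentPlane n M) : Prop :=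
  E ∈ integralElements J p ∧
  ∃ F : ℕ → Submodule ℝ (Tan n E.1), IsFlag p E F ∧ ∀ k < p, IsKahlerRegular J k ⟨E.1, F k⟩

/-- The system `J` (for `p`-dimensional integral manifolds) is involutive at `x`: there is an
ordinary `p`-dimensional integral element `E ⊆ T_x M`. -/
def IsInvolutiveAt (p : ℕ) (x : M) : Prop :=
  ∃ E : Submodule ℝ (Tan n x), IsOrdinary J p ⟨x, E⟩

/-! ### Parallel calibrations and the system they define -/

variable [Bundle.RiemannianBundle (fun x : M => TangentSpace (𝓡 n) x)]

/-- The infinitesimal action of an endomorphism `θ` on a `p`-form `φ`, evaluated on `v`. -/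
def derivationAct {V : Type*} [AddCommGroup V] [Module ℝ V] {p : ℕ} (θ : V →ₗ[ℝ] V)
    (φ : V [⋀^Fin p]→ₗ[ℝ] ℝ) (v : Fin p → V) : ℝ :=
  ∑ a, φ (Function.update v a (θ (v a)))

/-- The space `𝓟`: smooth `p`-forms `ψ` such that, for every `x`, `ψ_x = θ.φ_x` for some
skew-symmetric endomorphism `θ ∈ 𝔬(T_x M)`. -/
def criticalSystem {p : ℕ} (φ : Form n M p) : Set (Form n M p) :=
  {ψ | IsSmoothForm ψ ∧ ∀ x, ∃ θ : Tan n x →ₗ[ℝ] Tan n x,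
    (∀ u v, inner ℝ (θ u) v = - inner ℝ u (θ v)) ∧ ∀ v, ψ x v = derivationAct θ (φ x) v}

/-- The exterior differential system `𝓘`: the ideal algebraically generated by `𝓟`. -/
def criticalIdeal {p : ℕ} (φ : Form n M p) (k : ℕ) : Submodule ℝ (Form n M k) :=
  idealGeneratedBy (criticalSystem φ) k

variable [IsContMDiffRiemannianBundle (𝓡 n) ∞ (Model n) (fun x : M => TangentSpace (𝓡 n) x)]

/-- A smooth Riemannian metric is in particular `C¹`. -/
instance isContMDiffRiemannianBundle_one :
    IsContMDiffRiemannianBundle (𝓡 n) 1 (Model n) (fun x : M => TangentSpace (𝓡 n) x) :=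
  IsContMDiffRiemannianBundle.of_le (n := ∞) (by exact_mod_cast le_top)

/-- `φ` is parallel: `∇φ = 0` for the Levi-Civita (torsion free and metric) connection `∇`, i.e.
`u(φ(Y₁, …, Y_p)) = ∑_a φ(Y₁, …, ∇_u Y_a, …, Y_p)`. -/
def IsParallel {p : ℕ} (φ : Form n M p) : Prop :=
  ∃ cov : CovariantDerivative (𝓡 n) (Model n) (TangentSpace (𝓡 n) : M → Type),
    cov.torsion = 0 ∧ cov.IsMetricCompatible ∧
    ∀ (x : M) (Y : Fin p → ∀ z : M, Tan n z), (∀ a, DifferentiableFieldAt (Y a) x) →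
      ∀ u : Tan n x,
        mfderiv (𝓡 n) 𝓘(ℝ, ℝ) (fun z => φ z (fun a => Y a z)) x u =
          ∑ a, φ x (Function.update (fun b => Y b x) a (cov (Y a) x u))

/-- A parallel calibration: a smooth parallel (hence closed) `p`-form with `φ ≤ 1` on all
orthonormal `p`-tuples. -/
structure IsParallelCalibration {p : ℕ} (φ : Form n M p) : Prop where
  smooth : IsSmoothForm φ
  parallel : IsParallel φ
  le_one : ∀ (x : M) (e : Fin p → Tan n x), Orthonormal ℝ e → φ x e ≤ 1

end Manifold

end EDS

end

/-! Everything is tested on the rank two rotations `θ = skewMap a b`; bump functions extend each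
`θ.φ_x` to a form in the system (`exists_mem_criticalSystem`). The ideal has no forms below degree
p, so every plane of dimension less than p is Kähler-ordinary, and the only polar spaces of a flag
that can be proper are those of hyperplanes F in E.

For (1), let v be in H(F), with component w orthogonal to E, and let e₀ in E be orthogonal to F. The
rotation in the plane of w and e₀ kills F and sends w to |w|² e₀, so its form takes the value |w|²
φ(e₀, F) on (w, F). When φ is nonzero on E this forces w = 0, so H(F) = E (`polarSpace_eq`). The
codimensions come from forms whose differentials at E are dual, up to the factor φ(E), to rank one
variations of E: either w ranges over an orthonormal basis of the normal space with one e_a fixed,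
which gives n - p forms, or one w is fixed and a varies, which gives p forms.

For (2), an ordinary E would have a Kähler-regular hyperplane F with E ⊆ H(F), so dim H(F) ≥ p. Some
hyperplane, however, has a polar space of dimension less than p (`exists_det_skewMatrix_ne_zero`):
near a frame maximizing |φ_x| the plane can be moved, when n < 2p, so that n - p of the forms still
vanish on it while another does not. This is the nonvanishing of a determinant that is polynomial
along lines, so it also occurs arbitrarily close to F. There all planes are Kähler-ordinary, which
contradicts the constancy of dim H. The argument needs φ_x ≠ 0, which holds at every point because a
parallel form has locally constant length and M is connected (`IsParallel.ne_zero`). -/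

noncomputable section

namespace EDS

/-! ### Infinitesimal rotations acting on alternating forms -/

section Algebra

variable {V : Type*} [AddCommGroup V] [Module ℝ V] {p : ℕ}

/-- The alternating form `θ.φ`. -/
def derivationForm (θ : V →ₗ[ℝ] V) (φ : V [⋀^Fin p]→ₗ[ℝ] ℝ) : V [⋀^Fin p]→ₗ[ℝ] ℝ :=
  { ∑ a, φ.toMultilinearMap.compLinearMap (Function.update (fun _ => LinearMap.id) a θ) with
    map_eq_zero_of_eq' := by
      intro v i j hv hij
      have key : ∀ a, (φ.toMultilinearMap.compLinearMap
          (Function.update (fun _ => LinearMap.id) a θ)) v = φ (Function.update v a (θ (v a))) := by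
        intro a
        simp only [MultilinearMap.compLinearMap_apply, AlternatingMap.coe_multilinearMap]
        congr 1
        ext b
        by_cases hb : b = a
        · subst hb; simp
        · simp [hb]
      simp only [MultilinearMap.toFun_eq_coe, _root_.sum_apply, key]
      -- With v i = v j, the terms where `θ` acts in another slot keep a repeated argument; the
      -- terms of the slots i and j differ by a transposition and cancel.
      rw [← Finset.add_sum_erase _ _ (Finset.mem_univ i),
        ← Finset.add_sum_erase _ _ (Finset.mem_erase.2 ⟨hij.symm, Finset.mem_univ j⟩),
        Finset.sum_eq_zero, add_zero]
      · have h := φ.map_swap (Function.update v i (θ (v i))) hij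
        rw [add_eq_zero_iff_eq_neg, ← neg_eq_iff_eq_neg, ← h]
        congr 1
        ext b
        by_cases hbi : b = i
        · subst hbi; simp [hij, hij.symm, hv]
        · by_cases hbj : b = j
          · subst hbj; simp [hv]
          · simp [Equiv.swap_apply_of_ne_of_ne hbi hbj, hbi, hbj]
      · intro a ha
        simp only [Finset.mem_erase, Finset.mem_univ, and_true] at ha
        exact φ.map_eq_zero_of_eq _ (i := i) (j := j)
          (by simp [ha.1.symm, ha.2.symm, hv]) hij }

theorem derivationForm_apply (θ : V →ₗ[ℝ] V) (φ : V [⋀^Fin p]→ₗ[ℝ] ℝ) (v : Fin p → V) :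
    derivationForm θ φ v = derivationAct θ φ v := by
  change (∑ a, φ.toMultilinearMap.compLinearMap (Function.update (fun _ => LinearMap.id) a θ)) v = _
  rw [_root_.sum_apply]
  refine Finset.sum_congr rfl fun a _ => ?_
  simp only [MultilinearMap.compLinearMap_apply, AlternatingMap.coe_multilinearMap]
  congr 1
  ext b
  by_cases hb : b = a
  · subst hb; simp
  · simp [hb]

/-- If `θ` kills all vectors but one, then `θ.φ` has only one term. -/
theorem derivationForm_apply_of_forall_ne (θ : V →ₗ[ℝ] V) (φ : V [⋀^Fin p]→ₗ[ℝ] ℝ)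
    (v : Fin p → V) (a : Fin p) (h : ∀ b, b ≠ a → θ (v b) = 0) :
    derivationForm θ φ v = φ (Function.update v a (θ (v a))) := by
  rw [derivationForm_apply, derivationAct, Finset.sum_eq_single a]
  · intro b _ hb
    rw [h b hb]
    exact φ.map_coord_zero b (by simp)
  · simp

/-- Expansion of the value of an alternating form on linear combinations. -/
theorem map_sum_smul {ι : Type*} [Fintype ι] (φ : V [⋀^Fin p]→ₗ[ℝ] ℝ) (b : ι → V)
    (c : Fin p → ι → ℝ) :
    φ (fun a => ∑ i, c a i • b i) =
      ∑ I : Fin p → ι, (∏ a, c a (I a)) * φ (fun a => b (I a)) := by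
  classical
  refine (φ.toMultilinearMap.map_sum (fun a i => c a i • b i)).trans
    (Finset.sum_congr rfl fun I _ => ?_)
  exact φ.toMultilinearMap.map_smul_univ (fun a => c a (I a)) (fun a => b (I a))

/-- Two coordinates in the same direction make an alternating form vanish, so that it is affine
along rank one perturbations. -/
theorem map_add_smul_const (φ : V [⋀^Fin p]→ₗ[ℝ] ℝ) (e : Fin p → V) (β : Fin p → ℝ) (w : V) :
    φ (fun b => e b + β b • w) = φ e + ∑ b, β b * φ (Function.update e b w) := by
  have h := φ.toMultilinearMap.map_add_eq_map_add_linearDeriv_add e (fun b => β b • w)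
  rw [Finset.sum_eq_zero, add_zero, MultilinearMap.linearDeriv_apply] at h
  · simpa [Pi.add_def] using h
  · intro s hs
    obtain ⟨i, hi, j, hj, hij⟩ := Finset.one_lt_card.1 (Finset.mem_filter.1 hs).2
    refine φ.map_linearDependent _ fun hli => ?_
    have h1 := hli.comp ![i, j] (by
      intro x y; fin_cases x <;> fin_cases y <;> simp [hij, hij.symm])
    have h0 : s.piecewise (fun b => β b • w) e ∘ ![i, j] = ![β i • w, β j • w] := by
      ext x; fin_cases x <;> simp [hi, hj]
    rw [h0] at h1
    have h2 := LinearIndependent.pair_iff.1 h1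
    -- The relation β_j (β_i w) - β_i (β_j w) = 0 would force β_i = 0, and then the vector β_i w of
    -- an independent pair would be zero.
    have h3 := h2 (β j) (- β i) (by simp [smul_smul, mul_comm])
    have h4 := h1.ne_zero 0
    exact h4 (by simp [neg_eq_zero.1 h3.2])

/-- An alternating form is a polynomial along each line. -/
theorem analytic_map_line (φ : V [⋀^Fin p]→ₗ[ℝ] ℝ) (u v : Fin p → V) :
    AnalyticOnNhd ℝ (fun t : ℝ => φ (fun a => u a + t • v a)) Set.univ := by
  have h : (fun t : ℝ => φ (fun a => u a + t • v a)) = fun t : ℝ =>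
      ∑ s : Finset (Fin p), t ^ (sᶜ).card * φ (s.piecewise u v) := by
    ext t
    have h1 := φ.toMultilinearMap.map_add_univ u (fun a => t • v a)
    have h2 : (u + fun a => t • v a) = fun a => u a + t • v a := rfl
    rw [h2] at h1
    refine h1.trans (Finset.sum_congr rfl fun s _ => ?_)
    have h3 := φ.toMultilinearMap.map_piecewise_smul (fun _ => t) (s.piecewise u v) sᶜ
    rw [Finset.prod_const] at h3
    refine Eq.trans ?_ h3
    congr 1
    ext a
    by_cases ha : a ∈ s <;> simp [ha]
  rw [h]
  intro t _
  fun_prop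

end Algebra

/-! ### Rank two rotations evaluated on orthonormal frames -/

section Inner

variable {V : Type*} [NormedAddCommGroup V] [InnerProductSpace ℝ V] {p : ℕ}

/-- The skew-symmetric endomorphism `u ↦ ⟨a, u⟩ b - ⟨b, u⟩ a`. -/
def skewMap (a b : V) : V →ₗ[ℝ] V :=
  (innerₛₗ ℝ a).smulRight b - (innerₛₗ ℝ b).smulRight a

theorem skewMap_apply (a b u : V) : skewMap a b u = inner ℝ a u • b - inner ℝ b u • a := by
  simp [skewMap]

theorem inner_skewMap (a b u v : V) :
    inner ℝ (skewMap a b u) v = - inner ℝ u (skewMap a b v) := by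
  simp only [skewMap_apply, inner_sub_left, inner_sub_right, real_inner_smul_left,
    real_inner_smul_right]
  rw [real_inner_comm u a, real_inner_comm u b]
  ring

/-- The form `θ.φ` for the rank two skew-symmetric `θ = skewMap a b`. -/
def skewForm (φ : V [⋀^Fin p]→ₗ[ℝ] ℝ) (a b : V) : V [⋀^Fin p]→ₗ[ℝ] ℝ :=
  derivationForm (skewMap a b) φ

variable (φ : V [⋀^Fin p]→ₗ[ℝ] ℝ) {e : Fin p → V}

/-- The rotation kills every e b with b ≠ a and sends w' to ⟨w, w'⟩ e a. Together with
`skewForm_update_of_ne` this supplies the Kronecker deltas in all the independence arguments. -/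
theorem skewForm_update_self (he : Orthonormal ℝ e) (a : Fin p) {w w' : V}
    (hw : ∀ b, inner ℝ w (e b) = 0) (hw' : ∀ b, inner ℝ w' (e b) = 0) :
    skewForm φ w (e a) (Function.update e a w') = inner ℝ w w' * φ e := by
  rw [skewForm, derivationForm_apply_of_forall_ne _ _ _ a]
  · simp only [Function.update_self, Function.update_idem, skewMap_apply,
      real_inner_comm w' (e a), hw']
    rw [zero_smul, sub_zero, AlternatingMap.map_update_smul, Function.update_eq_self, smul_eq_mul]
  · intro b hb
    simp [skewMap_apply, hb, hw, he.2 hb.symm]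

theorem skewForm_update_of_ne (he : Orthonormal ℝ e) {a b : Fin p} (hab : b ≠ a) {w : V}
    (hw : ∀ b, inner ℝ w (e b) = 0) :
    skewForm φ w (e a) (Function.update e b w) = 0 := by
  rw [skewForm, derivationForm_apply, derivationAct]
  -- In slot b the rotation turns w into |w|² e a, which repeats slot a; in slot a it turns e a into
  -- -w, which repeats slot b; in every other slot it gives zero.
  refine Finset.sum_eq_zero fun c _ => ?_
  by_cases hcb : c = b
  · subst hcb
    rw [Function.update_self, Function.update_idem, skewMap_apply, real_inner_comm w (e a), hw,
      zero_smul, sub_zero, AlternatingMap.map_update_smul, φ.map_update_self _ hab, smul_zero]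
  · by_cases hca : c = a
    · subst hca
      have h := φ.map_update_self (Function.update e b w) hcb
      rw [Function.update_self] at h
      rw [Function.update_of_ne hcb, skewMap_apply, hw, zero_smul, zero_sub, ← neg_smul,
        AlternatingMap.map_update_smul, h, smul_zero]
    · refine φ.map_coord_zero c ?_
      simp [skewMap_apply, hcb, hw, he.2 (Ne.symm hca)]

/-- The value of `skewForm φ w (e a)` on a plane containing the `e b`. -/
theorem skewForm_self (he : Orthonormal ℝ e) (a : Fin p) {w : V}
    (hw : ∀ b, inner ℝ w (e b) = 0) :
    skewForm φ w (e a) e = - φ (Function.update e a w) := by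
  rw [skewForm, derivationForm_apply_of_forall_ne _ _ _ a]
  · rw [skewMap_apply, hw, real_inner_self_eq_norm_sq, he.1]
    rw [zero_smul, zero_sub, one_pow, one_smul, ← neg_one_smul ℝ w, AlternatingMap.map_update_smul]
    simp
  · intro b hb
    simp [skewMap_apply, hw, he.2 hb.symm]

end Inner

/-! ### Maximizing frames, and a hyperplane with small polar space -/

section Minor

variable {V : Type*} [NormedAddCommGroup V] [InnerProductSpace ℝ V] [FiniteDimensional ℝ V]

theorem continuous_alternatingMap {p : ℕ} (φ : V [⋀^Fin p]→ₗ[ℝ] ℝ) : Continuous φ := by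
  let b := stdOrthonormalBasis ℝ V
  have h : (φ : (Fin p → V) → ℝ) = fun v => ∑ I : Fin p → Fin (Module.finrank ℝ V),
      (∏ a, inner ℝ (b (I a)) (v a)) * φ (fun a => b (I a)) := by
    ext v
    rw [← map_sum_smul φ b (fun a i => inner ℝ (b i) (v a))]
    simp only [b.sum_repr']
  rw [h]
  fun_prop

omit [FiniteDimensional ℝ V] in
theorem _root_.Orthonormal.update {ι : Type*} [DecidableEq ι] {e : ι → V}
    (he : Orthonormal ℝ e) {a : ι} {u : V} (hu : ‖u‖ = 1) (h : ∀ b, b ≠ a → inner ℝ u (e b) = 0) :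
    Orthonormal ℝ (Function.update e a u) := by
  refine ⟨fun b => ?_, fun b c hbc => ?_⟩
  · by_cases hb : b = a
    · subst hb; simpa
    · simp [hb, he.1 b]
  · change inner ℝ (Function.update e a u b) (Function.update e a u c) = 0
    by_cases hb : b = a
    · subst hb; simp [hbc.symm, h c hbc.symm]
    · by_cases hc : c = a
      · subst hc
        simp only [ne_eq, hb, not_false_eq_true, Function.update_of_ne, Function.update_self]
        rw [real_inner_comm]; exact h b hb
      · simp [hb, hc, he.2 hbc]

/-- A form attains its maximum on orthonormal frames. -/
theorem exists_orthonormal_isMax {p : ℕ} (φ : V [⋀^Fin p]→ₗ[ℝ] ℝ) (hφ : φ ≠ 0) :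
    ∃ e : Fin p → V, Orthonormal ℝ e ∧ φ e ≠ 0 ∧
      ∀ e' : Fin p → V, Orthonormal ℝ e' → |φ e'| ≤ |φ e| := by
  have hcont : Continuous φ := continuous_alternatingMap φ
  have hcpt : IsCompact {e : Fin p → V | Orthonormal ℝ e} := by
    refine Metric.isCompact_of_isClosed_isBounded ?_ ?_
    · simp only [orthonormal_iff_ite, Set.ofPred_forall]
      exact isClosed_iInter fun i => isClosed_iInter fun j =>
        isClosed_eq (by fun_prop) continuous_const
    · refine (Metric.isBounded_closedBall (x := (0 : Fin p → V)) (r := 1)).subset fun e he => ?_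
      rw [mem_closedBall_zero_iff, pi_norm_le_iff_of_nonneg zero_le_one]
      exact fun i => (he.1 i).le
  obtain ⟨e₁, he₁, hne⟩ : ∃ e : Fin p → V, Orthonormal ℝ e ∧ φ e ≠ 0 := by
    by_contra! h
    refine hφ (Module.Basis.ext_alternating (stdOrthonormalBasis ℝ V).toBasis fun v hv => ?_)
    simp only [OrthonormalBasis.coe_toBasis]
    exact h _ ((stdOrthonormalBasis ℝ V).orthonormal.comp v hv)
  obtain ⟨e, he, hmax⟩ := hcpt.exists_isMaxOn ⟨e₁, he₁⟩ (f := fun e => |φ e|)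
    (hcont.abs.continuousOn)
  exact ⟨e, he, fun h0 => hne (by simpa [h0] using hmax he₁), fun e' he' => hmax he'⟩

omit [FiniteDimensional ℝ V] in
/-- The first order condition at a maximum. -/
theorem map_update_eq_zero_of_isMax {p : ℕ} (φ : V [⋀^Fin p]→ₗ[ℝ] ℝ) {e : Fin p → V}
    (he : Orthonormal ℝ e)
    (hmax : ∀ e' : Fin p → V, Orthonormal ℝ e' → |φ e'| ≤ |φ e|) (a : Fin p) {w : V}
    (hw : ∀ b, inner ℝ w (e b) = 0) : φ (Function.update e a w) = 0 := by
  rcases eq_or_ne w 0 with rfl | hw0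
  · exact φ.map_coord_zero a (by simp)
  have hn : ‖w‖ ≠ 0 := norm_ne_zero_iff.2 hw0
  set c := φ e with hc
  set d := φ (Function.update e a (‖w‖⁻¹ • w)) with hd
  suffices h : d = 0 by
    rw [hd, AlternatingMap.map_update_smul, smul_eq_mul] at h
    exact (mul_eq_zero.1 h).resolve_left (inv_ne_zero hn)
  by_contra hd0
  -- Rotating e a towards w/|w| by the angle with cosine c/r and sine d/r gives the value r, which
  -- exceeds |c| unless d = 0. No differentiation is needed.
  set r := √(c ^ 2 + d ^ 2) with hr
  have hpos : 0 < c ^ 2 + d ^ 2 := by positivity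
  have hr0 : 0 < r := Real.sqrt_pos.2 hpos
  have hr2 : r ^ 2 = c ^ 2 + d ^ 2 := Real.sq_sqrt hpos.le
  have hwe : ∀ b, inner ℝ (e b) w = 0 := fun b => by rw [real_inner_comm]; exact hw b
  have horth := he.update (a := a) (u := (c / r) • e a + (d / r) • ‖w‖⁻¹ • w) (by
      rw [← sq_eq_sq₀ (norm_nonneg _) zero_le_one, one_pow, norm_add_sq_real]
      simp only [norm_smul, real_inner_smul_left, real_inner_smul_right, hwe, he.1 a, norm_inv,
        norm_norm, inv_mul_cancel₀ hn]
      simp only [mul_one, mul_zero, add_zero, Real.norm_eq_abs, sq_abs]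
      field_simp
      exact hr2.symm) (fun b hb => by
      simp [inner_add_left, real_inner_smul_left, hw, he.2 hb.symm])
  have hval := hmax _ horth
  rw [AlternatingMap.map_update_add, AlternatingMap.map_update_smul, AlternatingMap.map_update_smul,
    Function.update_eq_self, ← hc, ← hd, smul_eq_mul, smul_eq_mul] at hval
  have h1 : c / r * c + d / r * d = r := by
    field_simp
    linarith [hr2]
  rw [h1, abs_of_pos hr0] at hval
  have h2 : r ^ 2 ≤ c ^ 2 := by
    rw [← sq_abs c]
    exact pow_le_pow_left₀ hr0.le hval 2
  have : 0 < d ^ 2 := by positivity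
  linarith

/-- If the values of `k` forms `χ i` on `k` vectors have nonzero determinant, the common kernel of
these forms has codimension at least `k`. -/
theorem finrank_add_le_of_det_ne_zero {ι : Type*} [Fintype ι] [DecidableEq ι]
    (χ : ι → V →ₗ[ℝ] ℝ) (v : ι → V) (hdet : (Matrix.of fun i j => χ i (v j)).det ≠ 0)
    (H : Submodule ℝ V) (hH : ∀ u ∈ H, ∀ i, χ i u = 0) :
    Module.finrank ℝ H + Fintype.card ι ≤ Module.finrank ℝ V := by
  have hle : H ≤ LinearMap.ker (LinearMap.pi χ) := fun u hu => by
    rw [LinearMap.mem_ker]; ext i; exact hH u hu i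
  have hsurj : LinearMap.range (LinearMap.pi χ) = ⊤ := by
    rw [LinearMap.range_eq_top]
    intro y
    have hu : IsUnit (Matrix.of fun i j => χ i (v j)) :=
      (Matrix.isUnit_iff_isUnit_det _).2 hdet.isUnit
    obtain ⟨c, hc⟩ := Matrix.mulVec_surjective_iff_isUnit.2 hu y
    refine ⟨∑ j, c j • v j, ?_⟩
    rw [← hc]
    ext i
    simp [Matrix.mulVec, dotProduct, mul_comm]
  have h := LinearMap.finrank_range_add_finrank_ker (LinearMap.pi χ)
  rw [hsurj, finrank_top, Module.finrank_pi] at h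
  have := Submodule.finrank_mono hle
  omega

/-- The matrix of values of the forms `skewForm φ (a i) (b i)` on the planes spanned by `v j` and
`f`. -/
def skewMatrix {m : ℕ} {ι : Type*} (φ : V [⋀^Fin (m + 1)]→ₗ[ℝ] ℝ) (a b v : ι → V)
    (f : Fin m → V) : Matrix ι ι ℝ :=
  Matrix.of fun i j => skewForm φ (a i) (b i) (Matrix.vecCons (v j) f)

theorem finrank_add_le_of_det_skewMatrix_ne_zero {m : ℕ} {ι : Type*} [Fintype ι] [DecidableEq ι]
    (φ : V [⋀^Fin (m + 1)]→ₗ[ℝ] ℝ) (a b v : ι → V) (f : Fin m → V)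
    (hdet : (skewMatrix φ a b v f).det ≠ 0) (H : Submodule ℝ V)
    (hH : ∀ u ∈ H, ∀ i, skewForm φ (a i) (b i) (Matrix.vecCons u f) = 0) :
    Module.finrank ℝ H + Fintype.card ι ≤ Module.finrank ℝ V := by
  have hχ : ∀ i u, (skewForm φ (a i) (b i)).toMultilinearMap.toLinearMap (Matrix.vecCons 0 f) 0 u =
      skewForm φ (a i) (b i) (Matrix.vecCons u f) := by
    intro i u
    rw [MultilinearMap.toLinearMap_apply, AlternatingMap.coe_multilinearMap]
    congr 1
    ext1 c
    refine Fin.cases ?_ (fun c => ?_) c <;> simp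
  refine finrank_add_le_of_det_ne_zero (fun i => (skewForm φ (a i)
    (b i)).toMultilinearMap.toLinearMap (Matrix.vecCons 0 f) 0) v ?_ H fun u hu i => ?_
  · simp only [hχ]; exact hdet
  · rw [hχ, hH u hu]

theorem exists_orthonormal_compl {p : ℕ} {e : Fin p → V} (he : Orthonormal ℝ e) :
    ∃ w : Fin (Module.finrank ℝ V - p) → V, Orthonormal ℝ w ∧ ∀ i b, inner ℝ (w i) (e b) = 0 := by
  set K := Submodule.span ℝ (Set.range e)
  have hK : Module.finrank ℝ K = p := by
    simpa using finrank_span_eq_card he.linearIndependent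
  have hKo : Module.finrank ℝ Kᗮ = Module.finrank ℝ V - p := by
    have := K.finrank_add_finrank_orthogonal
    omega
  let b := (stdOrthonormalBasis ℝ Kᗮ).reindex (finCongr hKo)
  refine ⟨fun i => b i, b.orthonormal.comp_linearIsometry Kᗮ.subtypeₗᵢ, fun i c => ?_⟩
  rw [real_inner_comm]
  exact (b i).2 _ (Submodule.subset_span ⟨c, rfl⟩)

/-- At a maximizing frame e all the forms `skewForm φ (w i) (e c)` vanish on e, and those with c = 0
give k = dim V - (m + 1) independent conditions on vectors joined to e 1, …, e m. Tilting the frame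
in the direction β ⊗ w i₀ keeps these k forms zero on the tilted (m + 1)-plane for a suitable β,
while one further form becomes nonzero there. The resulting k + 1 conditions on the tilted
hyperplane f t cut the polar space down to dimension at most m. -/
theorem exists_det_skewMatrix_ne_zero {m : ℕ} (φ : V [⋀^Fin (m + 1)]→ₗ[ℝ] ℝ) (hφ : φ ≠ 0)
    (h1 : m + 1 < Module.finrank ℝ V) (h2 : Module.finrank ℝ V < 2 * (m + 1)) :
    ∃ (a b v : Fin (Module.finrank ℝ V - (m + 1)) ⊕ Unit → V) (f : Fin m → V),
      (skewMatrix φ a b v f).det ≠ 0 := by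
  obtain ⟨e, he, hc, hmax⟩ := exists_orthonormal_isMax φ hφ
  set k := Module.finrank ℝ V - (m + 1) with hk
  obtain ⟨w, hw, hwe⟩ : ∃ w : Fin k → V, Orthonormal ℝ w ∧ ∀ i b, inner ℝ (w i) (e b) = 0 :=
    exists_orthonormal_compl he
  have hcrit : ∀ i c, φ (Function.update e c (w i)) = 0 := fun i c =>
    map_update_eq_zero_of_isMax φ he hmax c (hwe i)
  have hψe : ∀ i c, skewForm φ (w i) (e c) e = 0 := fun i c => by
    rw [skewForm_self φ he c (hwe i), hcrit, neg_zero]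
  let i₀ : Fin k := ⟨0, by omega⟩
  -- a direction `β` along which the first `k` forms stay zero
  obtain ⟨β, hβ, hβ0⟩ : ∃ β : Fin (m + 1) → ℝ, (∀ i, ∑ c, β c *
      skewForm φ (w i) (e 0) (Function.update e c (w i₀)) = 0) ∧ β ≠ 0 := by
    let T : (Fin (m + 1) → ℝ) →ₗ[ℝ] (Fin k → ℝ) := Matrix.mulVecLin
      (Matrix.of fun i c => skewForm φ (w i) (e 0) (Function.update e c (w i₀)))
    -- These are k linear equations in m + 1 unknowns, and k < m + 1 is exactly dim V < 2 (m + 1).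
    have hT : LinearMap.ker T ≠ ⊥ := LinearMap.ker_ne_bot_of_finrank_lt (by simp; omega)
    obtain ⟨β, hβ, hβ0⟩ := (Submodule.ne_bot_iff _).1 hT
    refine ⟨β, fun i => ?_, hβ0⟩
    have := congrFun (LinearMap.mem_ker.1 hβ) i
    simpa [T, Matrix.mulVec, dotProduct, mul_comm] using this
  obtain ⟨c₀, hc₀⟩ := Function.ne_iff.1 hβ0
  rw [Pi.zero_apply] at hc₀
  let f : ℝ → Fin m → V := fun t c => e c.succ + (t * β c.succ) • w i₀
  let A : ℝ → Matrix (Fin k) (Fin k) ℝ := fun t =>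
    skewMatrix φ w (fun _ => e 0) w (f t)
  have hf : Continuous f := by fun_prop
  have hA : Continuous fun t => (A t).det := by
    refine Continuous.matrix_det (continuous_matrix fun i j => ?_)
    refine (continuous_alternatingMap (skewForm φ (w i) (e 0))).comp ?_
    refine continuous_pi fun c => ?_
    refine Fin.cases ?_ (fun c => ?_) c
    · exact continuous_const
    · exact (continuous_apply c).comp hf
  have hA0 : (A 0).det ≠ 0 := by
    have : A 0 = φ e • (1 : Matrix (Fin k) (Fin k) ℝ) := by
      ext i j
      have h0 : Matrix.vecCons (w j) (f 0) = Function.update e 0 (w j) := by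
        ext c
        refine Fin.cases ?_ (fun c => ?_) c <;> simp [f]
      change skewForm φ (w i) (e 0) (Matrix.vecCons (w j) (f 0)) = _
      rw [h0, skewForm_update_self φ he 0 (hwe i) (hwe j), (orthonormal_iff_ite.1 hw) i j]
      simp [Matrix.one_apply, Matrix.smul_apply]
    rw [this, Matrix.det_smul, Matrix.det_one, mul_one]
    exact pow_ne_zero _ hc
  -- The upper block is invertible for small t, but the lower corner t β c₀ φ(e) also needs t ≠ 0.
  obtain ⟨t, ht, ht0⟩ : ∃ t, (A t).det ≠ 0 ∧ t ≠ 0 := by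
    have h3 : ∀ᶠ t in 𝓝[≠] (0 : ℝ), (A t).det ≠ 0 :=
      (hA.continuousAt.eventually_ne hA0).filter_mono nhdsWithin_le_nhds
    exact (h3.and self_mem_nhdsWithin).exists
  have hline : Matrix.vecCons (e 0 + (t * β 0) • w i₀) (f t) =
      fun c => e c + (t * β c) • w i₀ := by
    ext c
    refine Fin.cases ?_ (fun c => ?_) c <;> simp [f]
  refine ⟨Sum.elim w (fun _ => w i₀), Sum.elim (fun _ => e 0) (fun _ => e c₀),
    Sum.elim w (fun _ => e 0 + (t * β 0) • w i₀), f t, ?_⟩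
  -- The last column belongs to the tilted vector e 0 + t β 0 w i₀, which completes f t to the
  -- tilted plane. Its upper part vanishes by the choice of β, so the matrix is block triangular.
  have hblock : skewMatrix φ (Sum.elim w (fun _ : Unit => w i₀))
      (Sum.elim (fun _ => e 0) (fun _ => e c₀)) (Sum.elim w (fun _ => e 0 + (t * β 0) • w i₀))
      (f t) = Matrix.fromBlocks (A t) 0
        (Matrix.of fun _ j => skewForm φ (w i₀) (e c₀) (Matrix.vecCons (w j) (f t)))
        (Matrix.of fun _ _ => t * β c₀ * φ e) := by
    ext (i | i) (j | j)
    · rfl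
    · change skewForm φ (w i) (e 0) (Matrix.vecCons (e 0 + (t * β 0) • w i₀) (f t)) = 0
      rw [hline, map_add_smul_const, hψe, zero_add]
      simp only [mul_assoc, ← Finset.mul_sum, hβ, mul_zero]
    · rfl
    · change skewForm φ (w i₀) (e c₀) (Matrix.vecCons (e 0 + (t * β 0) • w i₀) (f t)) =
        t * β c₀ * φ e
      rw [hline, map_add_smul_const, hψe, zero_add, Finset.sum_eq_single c₀]
      · rw [skewForm_update_self φ he c₀ (hwe i₀) (hwe i₀), real_inner_self_eq_norm_sq, hw.1]
        simp
      · intro c _ hcc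
        rw [skewForm_update_of_ne φ he hcc (hwe i₀), mul_zero]
      · simp
  rw [hblock, Matrix.det_fromBlocks_zero₁₂, Matrix.det_unique (n := Unit)]
  exact mul_ne_zero ht (mul_ne_zero (mul_ne_zero ht0 hc₀) hc)

omit [FiniteDimensional ℝ V] in
theorem analytic_det_skewMatrix {m : ℕ} {ι : Type*} [Fintype ι] [DecidableEq ι]
    (φ : V [⋀^Fin (m + 1)]→ₗ[ℝ] ℝ) (a b v : ι → V) (f g : Fin m → V) :
    AnalyticOnNhd ℝ (fun t : ℝ => (skewMatrix φ a b v (fun c => f c + t • g c)).det) Set.univ := by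
  have h : ∀ i j, AnalyticOnNhd ℝ
      (fun t : ℝ => skewMatrix φ a b v (fun c => f c + t • g c) i j) Set.univ := by
    intro i j
    have := analytic_map_line (skewForm φ (a i) (b i)) (Matrix.vecCons (v j) f) (Matrix.vecCons 0 g)
    convert this using 3 with t
    change skewForm φ (a i) (b i) _ = _
    congr 1
    ext c
    refine Fin.cases ?_ (fun c => ?_) c <;> simp
  simp only [Matrix.det_apply']
  intro t _
  refine Finset.analyticAt_fun_sum _ fun σ _ => ?_
  refine analyticAt_const.mul (Finset.analyticAt_fun_prod _ fun i _ => h _ _ t trivial)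

end Minor

/-- The planes `span (frame + s g)` have arbitrarily small coordinates in the affine chart of the
Grassmannian given by `frame` and `C`, for small `s`. -/
theorem eventually_exists_span_eq {W : Type*} [NormedAddCommGroup W] [NormedSpace ℝ W] {m : ℕ}
    (frame : Fin m → W) (C : Submodule ℝ W)
    (hC : IsCompl (Submodule.span ℝ (Set.range frame)) C) (g : Fin m → W)
    {N : Set (Fin m → C)} (hN : N ∈ 𝓝 0) :
    ∀ᶠ s in 𝓝 (0 : ℝ), ∃ A ∈ N, Submodule.span ℝ (Set.range fun a => frame a + (A a : W)) =
      Submodule.span ℝ (Set.range fun a => frame a + s • g a) := by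
  have hdec : ∀ a, ∃ (c : Fin m → ℝ) (h : C), ∑ b, c b • frame b + (h : W) = g a := by
    intro a
    obtain ⟨u, hu, h, hh, hsum⟩ := Submodule.mem_sup.1
      (show g a ∈ Submodule.span ℝ (Set.range frame) ⊔ C by rw [hC.sup_eq_top]; trivial)
    obtain ⟨c, rfl⟩ := (Submodule.mem_span_range_iff_exists_fun ℝ).1 hu
    exact ⟨c, ⟨h, hh⟩, hsum⟩
  choose G h hGh using hdec
  -- Writing g = G frame + h with h in C gives frame + s g = B frame + s h, so for invertible B the
  -- affine coordinates are s B⁻¹ h. The adjugate formula makes their continuity at s = 0 visible.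
  let B : ℝ → Matrix (Fin m) (Fin m) ℝ := fun s => 1 + s • Matrix.of G
  have hB : Continuous B := by fun_prop
  have hdet : Continuous fun s => (B s).det := hB.matrix_det
  have hB0 : (B 0).det ≠ 0 := by simp [B]
  let A : ℝ → Fin m → C := fun s a => ∑ b, (((B s).det)⁻¹ * (B s).adjugate a b * s) • h b
  have hA : ContinuousAt A 0 := by
    refine continuousAt_pi.2 fun a => ?_
    refine tendsto_finsetSum _ fun b _ => ?_
    have h1 : ContinuousAt (fun s => ((B s).det)⁻¹) 0 := hdet.continuousAt.inv₀ hB0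
    have h2 : Continuous fun s => (B s).adjugate a b := hB.matrix_adjugate.matrix_elem a b
    exact ((h1.mul h2.continuousAt).mul continuousAt_id).smul continuousAt_const
  have hA0 : A 0 = 0 := by ext a; simp [A]
  filter_upwards [hdet.continuousAt.eventually_ne hB0, hA.preimage_mem_nhds (hA0 ▸ hN)] with s hs hAs
  have hinv : (B s)⁻¹ = (B s).det⁻¹ • (B s).adjugate := by
    rw [Matrix.inv_def, Ring.inverse_eq_inv']
  have hsg : ∀ b, frame b + s • g b = ∑ c, B s b c • frame c + s • (h b : W) := by
    intro b
    rw [← hGh b, smul_add, ← add_assoc]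
    congr 1
    simp [B, Matrix.one_apply, add_smul, Finset.sum_add_distrib, Finset.smul_sum, smul_smul]
  have hAa : ∀ a, frame a + (A s a : W) = ∑ b, (B s)⁻¹ a b • (frame b + s • g b) := by
    intro a
    simp only [hsg, smul_add, Finset.sum_add_distrib]
    congr 1
    · have h1 : ∀ c, ∑ b, (B s)⁻¹ a b * B s b c = (1 : Matrix (Fin m) (Fin m) ℝ) a c := by
        intro c
        rw [← Matrix.nonsing_inv_mul _ (isUnit_iff_ne_zero.2 hs), Matrix.mul_apply]
      simp only [Finset.smul_sum, smul_smul]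
      rw [Finset.sum_comm]
      simp [← Finset.sum_smul, h1, Matrix.one_apply]
    · simp [A, hinv, smul_smul, mul_assoc]
  have hgA : ∀ b, frame b + s • g b = ∑ a, B s b a • (frame a + (A s a : W)) := by
    intro b
    have h1 : ∀ c, ∑ a, B s b a * (B s)⁻¹ a c = (1 : Matrix (Fin m) (Fin m) ℝ) b c := by
      intro c
      rw [← Matrix.mul_nonsing_inv _ (isUnit_iff_ne_zero.2 hs), Matrix.mul_apply]
    simp only [hAa, Finset.smul_sum, smul_smul]
    rw [Finset.sum_comm]
    simp only [← Finset.sum_smul, h1, Matrix.one_apply, ite_smul, one_smul, zero_smul]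
    simp
  refine ⟨A s, hAs, le_antisymm ?_ ?_⟩
  · rw [Submodule.span_le]
    rintro _ ⟨a, rfl⟩
    simp only [hAa]
    exact Submodule.sum_mem _ fun b _ => Submodule.smul_mem _ _ (Submodule.subset_span ⟨b, rfl⟩)
  · rw [Submodule.span_le]
    rintro _ ⟨b, rfl⟩
    simp only [hgA b]
    exact Submodule.sum_mem _ fun a _ => Submodule.smul_mem _ _ (Submodule.subset_span ⟨a, rfl⟩)

/-! ### Smooth fields and forms -/

section Manifold

variable {n : ℕ} {M : Type*} [TopologicalSpace M] [ChartedSpace (Model n) M]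
  [IsManifold (𝓡 n) ∞ M]

instance (x : M) : FiniteDimensional ℝ (Tan n x) :=
  inferInstanceAs (FiniteDimensional ℝ (Model n))

omit [IsManifold (𝓡 n) ∞ M] in
theorem finrank_tan (x : M) : Module.finrank ℝ (Tan n x) = n :=
  (finrank_euclideanSpace_fin : Module.finrank ℝ (Model n) = n)

theorem smoothFieldAt_chartDeriv (x₀ : M) (v : Model n) {z : M}
    (hz : z ∈ (chartAt (Model n) x₀).source) :
    SmoothFieldAt (fun z => chartDeriv x₀ z v) z := by
  set e := trivializationAt (Model n) (TangentSpace (𝓡 n) : M → Type) x₀ with he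
  have h : ContMDiffOn (𝓡 n) ((𝓡 n).prod 𝓘(ℝ, Model n)) ∞
      (fun z => (⟨z, chartDeriv x₀ z v⟩ : TangentBundle (𝓡 n) M)) e.baseSet := by
    rw [e.contMDiffOn_section_baseSet_iff]
    refine (contMDiffOn_const (c := v)).congr fun y hy => ?_
    have h : chartDeriv x₀ y v = e.symm y v := e.symmL_apply hy v
    exact (congrArg (fun u => (e ⟨y, u⟩).2) h).trans (congrArg Prod.snd (e.apply_mk_symm hy v))
  exact h.contMDiffAt (e.open_baseSet.mem_nhds (by simpa [he] using hz))

/-- The differential of the inverse chart, as a linear isomorphism. -/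
def chartEquiv (x₀ z : M) (hz : z ∈ (chartAt (Model n) x₀).source) : Model n ≃ₗ[ℝ] Tan n z :=
  (((trivializationAt (Model n) (TangentSpace (𝓡 n) : M → Type) x₀).continuousLinearEquivAt ℝ z
    (by simpa using hz)).symm).toLinearEquiv

theorem chartEquiv_apply (x₀ z : M) (hz : z ∈ (chartAt (Model n) x₀).source) (v : Model n) :
    chartEquiv x₀ z hz v = chartDeriv x₀ z v := 
  congrFun (Bundle.Trivialization.symm_continuousLinearEquivAt_eq _ (by simpa using hz)) v

theorem linearIndependent_chartDeriv {x₀ z : M} (hz : z ∈ (chartAt (Model n) x₀).source)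
    {ι : Type*} {b : ι → Model n} (hb : LinearIndependent ℝ b) :
    LinearIndependent ℝ (fun j => chartDeriv x₀ z (b j)) := by
  have := hb.map' (chartEquiv x₀ z hz).toLinearMap (chartEquiv x₀ z hz).ker
  have h : (fun j => chartDeriv x₀ z (b j)) = (chartEquiv x₀ z hz).toLinearMap ∘ b :=
    funext fun j => (chartEquiv_apply x₀ z hz _).symm
  rwa [h]

theorem linearIndependent_coordFrame {x₀ z : M} (hz : z ∈ (chartAt (Model n) x₀).source) :
    LinearIndependent ℝ (fun j => chartDeriv x₀ z (EuclideanSpace.basisFun (Fin n) ℝ j)) :=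
  linearIndependent_chartDeriv hz (EuclideanSpace.basisFun (Fin n) ℝ).orthonormal.linearIndependent

variable [T2Space M]

/-- A coordinate field is cut off by a bump function; the Hausdorff property makes the extension by
zero smooth. Global fields are needed because the members of the system are forms on all of M. -/
theorem exists_smoothField (x : M) (v : Tan n x) :
    ∃ Y : ∀ z : M, Tan n z, (∀ z, SmoothFieldAt Y z) ∧ Y x = v := by
  obtain ⟨u, rfl⟩ := (chartEquiv x x (mem_chart_source _ x)).surjective v
  let f : SmoothBumpFunction (𝓡 n) x := Classical.arbitrary _
  have h := ContMDiffOn.smul_section_of_tsupport (I := 𝓡 n) (V := (TangentSpace (𝓡 n) : M → Type))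
    (n := ∞)
    (s := fun z => chartDeriv x z u) (ψ := f) f.contMDiff.contMDiffOn
    (chartAt (Model n) x).open_source f.tsupport_subset_chartAt_source
    (fun z hz => (smoothFieldAt_chartDeriv x u hz).contMDiffWithinAt)
  refine ⟨fun z => f z • chartDeriv x z u, fun z => h z, ?_⟩
  change f x • chartDeriv x x u = _
  rw [f.eq_one, one_smul, chartEquiv_apply]

variable [Bundle.RiemannianBundle (fun x : M => TangentSpace (𝓡 n) x)]
variable [IsContMDiffRiemannianBundle (𝓡 n) ∞ (Model n) (fun x : M => TangentSpace (𝓡 n) x)]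

omit [T2Space M] in
theorem SmoothFieldAt.inner_field {X Y : ∀ z : M, Tan n z} {x : M} (hX : SmoothFieldAt X x)
    (hY : SmoothFieldAt Y x) : ContMDiffAt (𝓡 n) 𝓘(ℝ, ℝ) ∞ (fun z => inner ℝ (X z) (Y z)) x :=
  ContMDiffAt.inner_bundle (b := id) hX hY

/-- Every `θ.φ_x` with `θ` of rank two is the value of a form in `𝓟`. -/
theorem exists_mem_criticalSystem {p : ℕ} {φ : Form n M p} (hφ : IsSmoothForm φ) (x : M)
    (a b : Tan n x) : ∃ ψ ∈ criticalSystem φ, ψ x = skewForm (φ x) a b := by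
  obtain ⟨A, hA, rfl⟩ := exists_smoothField x a
  obtain ⟨B, hB, rfl⟩ := exists_smoothField x b
  refine ⟨fun z => skewForm (φ z) (A z) (B z), ⟨?_, fun z => ⟨skewMap (A z) (B z),
    inner_skewMap _ _, derivationForm_apply _ _⟩⟩, rfl⟩
  intro z Y hY
  simp only [skewForm, derivationForm_apply, derivationAct]
  refine ContMDiffAt.sum fun d _ => ?_
  have h := hφ z (Function.update Y d
    (fun y => inner ℝ (A y) (Y d y) • B y - inner ℝ (B y) (Y d y) • A y)) ?_
  · convert h using 3 with y
    ext1 c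
    by_cases hc : c = d
    · subst hc; simp [skewMap_apply]
    · simp [hc]
  · intro c
    by_cases hc : c = d
    · subst hc
      rw [Function.update_self]
      exact ContMDiffAt.sub_section (ContMDiffAt.smul_section ((hA z).inner_field (hY c)) (hB z))
        (ContMDiffAt.smul_section ((hB z).inner_field (hY c)) (hA z))
    · rw [Function.update_of_ne hc]
      exact hY c

end Manifold

/-! ### Parallel forms have constant length -/

/-- A skew-symmetric endomorphism acts on forms by a skew-symmetric endomorphism. -/
theorem sum_mul_sum_update_eq_zero {V : Type*} [NormedAddCommGroup V] [InnerProductSpace ℝ V]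
    {n p : ℕ} (φ : V [⋀^Fin p]→ₗ[ℝ] ℝ) (e : OrthonormalBasis (Fin n) ℝ V) (D : Fin n → V)
    (hD : ∀ i j, inner ℝ (D i) (e j) + inner ℝ (e i) (D j) = 0) :
    ∑ I : Fin p → Fin n, φ (fun a => e (I a)) *
      ∑ a, φ (Function.update (fun b => e (I b)) a (D (I a))) = 0 := by
  simp only [Finset.mul_sum]
  rw [Finset.sum_comm]
  refine Finset.sum_eq_zero fun a _ => ?_
  let T : (Fin p → Fin n) → ℝ := fun I => φ (fun b => e (I b))
  have hexp : ∀ I : Fin p → Fin n, φ (Function.update (fun b => e (I b)) a (D (I a))) =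
      ∑ j, inner ℝ (e j) (D (I a)) * T (Function.update I a j) := by
    intro I
    conv_lhs => rw [← e.sum_repr' (D (I a))]
    rw [AlternatingMap.map_update_sum]
    refine Finset.sum_congr rfl fun j _ => ?_
    rw [AlternatingMap.map_update_smul, smul_eq_mul]
    congr 2
    ext1 b
    by_cases hb : b = a
    · subst hb; simp
    · simp [hb]
  simp only [hexp, Finset.mul_sum]
  rw [← Finset.sum_product']
  -- This involution exchanges the index I a with the summation index j. It preserves the product of
  -- the two values of φ and changes the sign of the skew coefficient ⟨e j, D (I a)⟩.
  let σ : ((Fin p → Fin n) × Fin n) ≃ ((Fin p → Fin n) × Fin n) :=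
    { toFun := fun q => (Function.update q.1 a q.2, q.1 a)
      invFun := fun q => (Function.update q.1 a q.2, q.1 a)
      left_inv := fun q => by simp
      right_inv := fun q => by simp }
  have h : ∀ S : (Fin p → Fin n) × Fin n → ℝ, (∀ q, S (σ q) = - S q) → ∑ q, S q = 0 := by
    intro S hS
    have h1 := Equiv.sum_comp σ S
    simp only [hS, Finset.sum_neg_distrib] at h1
    linarith
  refine h _ fun q => ?_
  have hq := hD (q.1 a) q.2
  rw [real_inner_comm] at hq
  simp only [σ, Equiv.coe_fn_mk, Function.update_self, Function.update_idem,
    Function.update_eq_self]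
  change T _ * (_ * T _) = - (T _ * (_ * T _))
  linear_combination (T q.1 * T (Function.update q.1 a q.2)) * hq

section Manifold

variable {n : ℕ} {M : Type*} [TopologicalSpace M] [ChartedSpace (Model n) M]
  [IsManifold (𝓡 n) ∞ M]
  [Bundle.RiemannianBundle (fun x : M => TangentSpace (𝓡 n) x)]
  [IsContMDiffRiemannianBundle (𝓡 n) ∞ (Model n) (fun x : M => TangentSpace (𝓡 n) x)]

theorem SmoothFieldAt.gramSchmidt {s : Fin n → ∀ z : M, Tan n z} {x : M}
    (hs : ∀ i, SmoothFieldAt (s i) x) (hli : LinearIndependent ℝ (fun i => s i x)) (j : Fin n) :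
    SmoothFieldAt (fun z => InnerProductSpace.gramSchmidt ℝ (fun i => s i z) j) x := by
  induction j using WellFoundedLT.induction with
  | ind j ih =>
    have h : (fun z => InnerProductSpace.gramSchmidt ℝ (fun i => s i z) j) = fun z =>
        s j z - ∑ i ∈ Finset.Iio j, (inner ℝ (InnerProductSpace.gramSchmidt ℝ (fun i => s i z) i)
          (s j z) / inner ℝ (InnerProductSpace.gramSchmidt ℝ (fun i => s i z) i)
          (InnerProductSpace.gramSchmidt ℝ (fun i => s i z) i)) •
            InnerProductSpace.gramSchmidt ℝ (fun i => s i z) i := by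
      ext1 z
      rw [InnerProductSpace.gramSchmidt_def]
      simp only [Submodule.starProjection_singleton, real_inner_self_eq_norm_sq]
      rfl
    rw [h]
    refine ContMDiffAt.sub_section (hs j) (ContMDiffAt.sum_section fun i hi => ?_)
    have hi' := ih i (Finset.mem_Iio.1 hi)
    refine ContMDiffAt.smul_section ?_ hi'
    refine (hi'.inner_field (hs j)).div₀ (hi'.inner_field hi') ?_
    rw [inner_self_ne_zero]
    exact InnerProductSpace.gramSchmidt_ne_zero i hli

/-- The orthonormal frame obtained from the coordinate frame at `x₀`. -/
def orthoFrame (x₀ : M) (i : Fin n) (z : M) : Tan n z :=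
  InnerProductSpace.gramSchmidtNormed ℝ
    (fun j => chartDeriv x₀ z (EuclideanSpace.basisFun (Fin n) ℝ j)) i

omit [IsContMDiffRiemannianBundle (𝓡 n) ∞ (Model n) (fun x : M => TangentSpace (𝓡 n) x)] in
theorem orthonormal_orthoFrame {x₀ z : M} (hz : z ∈ (chartAt (Model n) x₀).source) :
    Orthonormal ℝ (fun i : Fin n => orthoFrame x₀ i z) :=
  InnerProductSpace.gramSchmidtNormed_orthonormal (linearIndependent_coordFrame hz)

theorem smoothFieldAt_orthoFrame {x₀ z : M} (hz : z ∈ (chartAt (Model n) x₀).source) (i : Fin n) :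
    SmoothFieldAt (fun z => orthoFrame x₀ i z) z := by
  have hli := linearIndependent_coordFrame hz
  have h := SmoothFieldAt.gramSchmidt (fun j => smoothFieldAt_chartDeriv x₀
    (EuclideanSpace.basisFun (Fin n) ℝ j) hz) hli i
  have h0 := InnerProductSpace.gramSchmidt_ne_zero i hli
  refine ContMDiffAt.smul_section (f := fun z => ‖InnerProductSpace.gramSchmidt ℝ
    (fun j => chartDeriv x₀ z (EuclideanSpace.basisFun (Fin n) ℝ j)) i‖⁻¹) ?_ h
  refine ContMDiffAt.inv₀ ?_ (norm_ne_zero_iff.2 h0)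
  simp only [norm_eq_sqrt_real_inner]
  exact ContDiffAt.comp_contMDiffAt (g := Real.sqrt)
    (Real.contDiffAt_sqrt (inner_self_ne_zero.2 h0)) (h.inner_field h)

/-- The orthonormal frame as an orthonormal basis. -/
def orthoBasis (x₀ z : M) (hz : z ∈ (chartAt (Model n) x₀).source) :
    OrthonormalBasis (Fin n) ℝ (Tan n z) :=
  OrthonormalBasis.mk (orthonormal_orthoFrame hz) (by
    rw [(orthonormal_orthoFrame hz).linearIndependent.span_eq_top_of_card_eq_finrank'
      (by simp [finrank_tan])])

omit [IsContMDiffRiemannianBundle (𝓡 n) ∞ (Model n) (fun x : M => TangentSpace (𝓡 n) x)] in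
theorem orthoBasis_apply (x₀ z : M) (hz : z ∈ (chartAt (Model n) x₀).source) (i : Fin n) :
    orthoBasis x₀ z hz i = orthoFrame x₀ i z := by
  simp [orthoBasis]

/-- The squared length of the form `φ_z`. -/
def normSqForm {p : ℕ} (φ : Form n M p) (x₀ z : M) : ℝ :=
  ∑ I : Fin p → Fin n, φ z (fun a => orthoFrame x₀ (I a) z) ^ 2

omit [IsContMDiffRiemannianBundle (𝓡 n) ∞ (Model n) (fun x : M => TangentSpace (𝓡 n) x)] in
theorem normSqForm_eq_zero_iff {p : ℕ} (φ : Form n M p) {x₀ z : M}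
    (hz : z ∈ (chartAt (Model n) x₀).source) : normSqForm φ x₀ z = 0 ↔ φ z = 0 := by
  constructor
  · intro h
    refine Module.Basis.ext_alternating (orthoBasis x₀ z hz).toBasis fun I _ => ?_
    have := (Finset.sum_eq_zero_iff_of_nonneg (fun _ _ => sq_nonneg _)).1 h I (Finset.mem_univ _)
    simpa [orthoBasis_apply] using this
  · intro h
    simp [normSqForm, h]

/-- In an orthonormal frame, parallelism expresses the derivative of each coefficient through ∇e_i.
Metric compatibility makes the matrix of ∇_u e_i skew, so the derivative of the sum of squares
vanishes by `sum_mul_sum_update_eq_zero`. -/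
theorem eventually_normSqForm_eq {p : ℕ} {φ : Form n M p} (hs : IsSmoothForm φ)
    (hφ : IsParallel φ) (x₀ : M) : ∀ᶠ z in 𝓝 x₀, normSqForm φ x₀ z = normSqForm φ x₀ x₀ := by
  set ξ := extChartAt (𝓡 n) x₀ with hξ
  have hopen : IsOpen ξ.target := isOpen_extChartAt_target x₀
  have hsrc : ∀ y ∈ ξ.target, ξ.symm y ∈ (chartAt (Model n) x₀).source := fun y hy => by
    simpa [hξ] using ξ.map_target hy
  have hsymm : ∀ y ∈ ξ.target, MDifferentiableAt 𝓘(ℝ, Model n) (𝓡 n) ξ.symm y := fun y hy =>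
    ((contMDiffOn_extChartAt_symm (n := ∞) x₀).contMDiffAt (hopen.mem_nhds hy)).mdifferentiableAt
      (by simp)
  have hsm : ∀ (I : Fin p → Fin n) (z : M), z ∈ (chartAt (Model n) x₀).source →
      MDifferentiableAt (𝓡 n) 𝓘(ℝ, ℝ) (fun z => φ z (fun a => orthoFrame x₀ (I a) z)) z :=
    fun I z hz => (hs z _ fun a => smoothFieldAt_orthoFrame hz (I a)).mdifferentiableAt (by simp)
  obtain ⟨cov, -, hmetric, hpar⟩ := hφ
  have hdiff : ∀ (I : Fin p → Fin n), ∀ y ∈ ξ.target, DifferentiableAt ℝ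
      (fun y => φ (ξ.symm y) (fun a => orthoFrame x₀ (I a) (ξ.symm y))) y := fun I y hy =>
    mdifferentiableAt_iff_differentiableAt.1
      (MDifferentiableAt.comp y (hsm I _ (hsrc y hy)) (hsymm y hy))
  have hderiv : ∀ (I : Fin p → Fin n), ∀ y ∈ ξ.target, ∀ u : Model n, fderiv ℝ
      (fun y => φ (ξ.symm y) (fun a => orthoFrame x₀ (I a) (ξ.symm y))) y u =
      ∑ a, φ (ξ.symm y) (Function.update (fun b => orthoFrame x₀ (I b) (ξ.symm y)) a
        (cov (fun z => orthoFrame x₀ (I a) z) (ξ.symm y)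
          (mfderiv 𝓘(ℝ, Model n) (𝓡 n) ξ.symm y u))) := by
    intro I y hy u
    have h1 := hpar (ξ.symm y) (fun a z => orthoFrame x₀ (I a) z)
      (fun a => (smoothFieldAt_orthoFrame (hsrc y hy) (I a)).mdifferentiableAt (by simp))
      (mfderiv 𝓘(ℝ, Model n) (𝓡 n) ξ.symm y u)
    rw [← h1, ← mfderiv_eq_fderiv]
    have h2 := mfderiv_comp y (hsm I _ (hsrc y hy)) (hsymm y hy)
    exact congrArg (fun L => L u) h2
  have hskew : ∀ y ∈ ξ.target, ∀ u : Tan n (ξ.symm y), ∀ i j,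
      inner ℝ (cov (fun z => orthoFrame x₀ i z) (ξ.symm y) u) (orthoFrame x₀ j (ξ.symm y)) +
      inner ℝ (orthoFrame x₀ i (ξ.symm y)) (cov (fun z => orthoFrame x₀ j z) (ξ.symm y) u) = 0 := by
    classical
    intro y hy u i j
    -- Only the value u at the point matters, so a field vanishing elsewhere serves as the direction
    -- of differentiation.
    have h1 := hmetric.mvfderiv_inner_eq (Function.update 0 (ξ.symm y) u)
      ((smoothFieldAt_orthoFrame (hsrc y hy) i).mdifferentiableAt (by simp))
      ((smoothFieldAt_orthoFrame (hsrc y hy) j).mdifferentiableAt (by simp))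
    simp only [Function.update_self] at h1
    rw [← h1]
    have h2 : (fun z => inner ℝ (orthoFrame x₀ i z) (orthoFrame x₀ j z)) =ᶠ[𝓝 (ξ.symm y)]
        fun _ => if i = j then (1 : ℝ) else 0 := by
      filter_upwards [(chartAt (Model n) x₀).open_source.mem_nhds (hsrc y hy)] with z hz
      exact orthonormal_iff_ite.1 (orthonormal_orthoFrame hz) i j
    have h3 := ((hasMFDerivAt_const (I := 𝓡 n) (I' := 𝓘(ℝ, ℝ)) (if i = j then (1 : ℝ) else 0)
      (ξ.symm y)).congr_of_eventuallyEq h2).mfderiv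
    exact congrArg (fun L => L u) h3
  have hG : ∀ y ∈ ξ.target, HasFDerivAt (fun y => normSqForm φ x₀ (ξ.symm y))
      (0 : Model n →L[ℝ] ℝ) y := by
    intro y hy
    have h1 : HasFDerivAt (fun y => normSqForm φ x₀ (ξ.symm y)) _ y :=
      HasFDerivAt.fun_sum fun I _ => ((hdiff I y hy).hasFDerivAt).pow 2
    refine h1.congr_fderiv (ContinuousLinearMap.ext fun u => ?_)
    have h2 := sum_mul_sum_update_eq_zero (φ (ξ.symm y)) (orthoBasis x₀ _ (hsrc y hy))
      (fun i => cov (fun z => orthoFrame x₀ i z) (ξ.symm y)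
        (mfderiv 𝓘(ℝ, Model n) (𝓡 n) ξ.symm y u)) (fun i j => by
        simpa only [orthoBasis_apply] using hskew y hy _ i j)
    simp only [orthoBasis_apply] at h2
    simp only [_root_.sum_apply, _root_.smul_apply, hderiv _ y hy, _root_.zero_apply, smul_eq_mul,
      nsmul_eq_mul, mul_assoc, ← Finset.mul_sum, Nat.add_one_sub_one, pow_one]
    rw [h2, mul_zero]
  obtain ⟨r, hr, hball⟩ := Metric.isOpen_iff.1 hopen (ξ x₀) (mem_extChartAt_target x₀)
  have hconst : ∀ y ∈ Metric.ball (ξ x₀) r, normSqForm φ x₀ (ξ.symm y) =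
      normSqForm φ x₀ (ξ.symm (ξ x₀)) := fun y hy =>
    Metric.isOpen_ball.is_const_of_fderiv_eq_zero (convex_ball _ _).isPreconnected
      (fun y hy => (hG y (hball hy)).differentiableAt.differentiableWithinAt)
      (fun y hy => (hG y (hball hy)).fderiv) hy (Metric.mem_ball_self hr)
  filter_upwards [(continuousAt_extChartAt (I := 𝓡 n) x₀).preimage_mem_nhds
    (Metric.ball_mem_nhds _ hr), extChartAt_source_mem_nhds (I := 𝓡 n) x₀] with z hz hzs
  have := hconst (ξ z) hz
  rwa [ξ.left_inv hzs, ξ.left_inv (mem_extChartAt_source x₀)] at this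

/-- On a connected manifold, a nonzero parallel form vanishes nowhere. -/
theorem IsParallel.ne_zero [ConnectedSpace M] {p : ℕ} {φ : Form n M p} (hs : IsSmoothForm φ)
    (hφ : IsParallel φ) (h0 : φ ≠ 0) (x : M) : φ x ≠ 0 := by
  have hloc : ∀ x, ∀ᶠ z in 𝓝 x, φ z = 0 ↔ φ x = 0 := fun x => by
    filter_upwards [eventually_normSqForm_eq hs hφ x,
      (chartAt (Model n) x).open_source.mem_nhds (mem_chart_source _ x)] with z hz hzs
    rw [← normSqForm_eq_zero_iff φ hzs, ← normSqForm_eq_zero_iff φ (mem_chart_source _ x), hz]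
  have hclopen : IsClopen {x | φ x = 0} := by
    refine ⟨⟨isOpen_iff_mem_nhds.2 fun x hx => ?_⟩, isOpen_iff_mem_nhds.2 fun x hx => ?_⟩
    · filter_upwards [hloc x] with z hz
      exact fun h => hx (hz.1 h)
    · filter_upwards [hloc x] with z hz
      exact hz.2 hx
  rcases isClopen_iff.1 hclopen with h | h
  · intro hx
    exact (Set.ext_iff.1 h x).1 hx
  · exact absurd (funext fun z => (Set.ext_iff.1 h z).2 trivial) h0

end Manifold

/-! ### The ideal and its integral elements -/

/-- The exterior product with the constant `1`. -/
theorem wedge_constOfIsEmpty_one {V : Type*} [AddCommGroup V] [Module ℝ V] {p : ℕ}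
    (ψ : V [⋀^Fin p]→ₗ[ℝ] ℝ) (h : 0 + p = p) :
    (wedge (AlternatingMap.constOfIsEmpty ℝ V (Fin 0) (1 : ℝ)) ψ).domDomCongr (finCongr h) = ψ := by
  ext v
  -- The exterior product sums over (0, p)-shuffles, of which there is only one: every permutation
  -- of `Fin 0 ⊕ Fin p` comes from one of `Fin p`.
  have hsub : Subsingleton (Equiv.Perm.ModSumCongr (Fin 0) (Fin p)) := by
    refine ⟨fun σ τ => ?_⟩
    induction σ using Quotient.inductionOn' with | _ σ => ?_
    induction τ using Quotient.inductionOn' with | _ τ => ?_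
    refine Quotient.sound' ?_
    rw [QuotientGroup.leftRel_apply]
    refine ⟨(1, (Equiv.emptySum (Fin 0) (Fin p)).permCongr (σ⁻¹ * τ)), ?_⟩
    ext i
    rcases i with i | i
    · exact i.elim0
    · simp [Equiv.permCongr_apply, Equiv.emptySum]
      rcases (Equiv.symm σ) (τ (Sum.inr i)) with k | k
      · exact k.elim0
      · simp
  rw [AlternatingMap.domDomCongr_apply, wedge, AlternatingMap.domDomCongr_apply,
    LinearMap.compAlternatingMap_apply, AlternatingMap.domCoprod_apply,
    _root_.sum_apply]
  have hσ : ∀ σ : Equiv.Perm.ModSumCongr (Fin 0) (Fin p),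
      σ = (Quotient.mk'' (1 : Equiv.Perm (Fin 0 ⊕ Fin p))) := fun σ => Subsingleton.elim _ _
  refine (congrArg (LinearMap.mul' ℝ ℝ) (Finset.sum_eq_single (Quotient.mk'' 1)
    (fun σ _ h => (h (hσ σ)).elim) (fun h => (h (Finset.mem_univ _)).elim))).trans ?_
  rw [AlternatingMap.domCoprod.summand_mk'']
  simp only [Equiv.Perm.sign_one, one_smul, MultilinearMap.domDomCongr_apply,
    MultilinearMap.domCoprod_apply, AlternatingMap.coe_multilinearMap,
    AlternatingMap.constOfIsEmpty_apply, LinearMap.mul'_apply, Function.const_apply, one_mul]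
  congr 1
  ext1 i
  simp

section Manifold

variable {n : ℕ} {M : Type*} [TopologicalSpace M] [ChartedSpace (Model n) M]
  [IsManifold (𝓡 n) ∞ M]

theorem mem_idealGeneratedBy {p : ℕ} {P : Set (Form n M p)} {ψ : Form n M p} (hψ : ψ ∈ P) :
    ψ ∈ idealGeneratedBy P p := by
  refine Submodule.subset_span ⟨0, zero_add p,
    fun x => AlternatingMap.constOfIsEmpty ℝ (Tan n x) (Fin 0) (1 : ℝ), ψ, ?_, hψ, fun x =>
      (wedge_constOfIsEmpty_one _ _).symm⟩
  intro x Y _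
  simpa using contMDiffAt_const

theorem idealGeneratedBy_eq_bot {p k : ℕ} (P : Set (Form n M p)) (hk : k < p) :
    idealGeneratedBy P k = ⊥ := by
  rw [idealGeneratedBy, Submodule.span_eq_bot]
  rintro χ ⟨j, h, -⟩
  omega

/-! ### Grassmann charts -/

theorem nonempty_grChart {k : ℕ} (x : M) (F : Submodule ℝ (Tan n x))
    (hF : Module.finrank ℝ F = k) : Nonempty (GrChart k (⟨x, F⟩ : TangentPlane n M)) := by
  subst hF
  let L := chartEquiv x x (mem_chart_source (Model n) x)
  let b := Module.finBasis ℝ F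
  let frame : Fin (Module.finrank ℝ F) → Model n := fun a => L.symm (b a)
  obtain ⟨C, hC⟩ := Submodule.exists_isCompl (Submodule.span ℝ (Set.range frame))
  refine ⟨⟨frame, C, ?_, ?_, hC⟩⟩
  · exact (b.linearIndependent.map' F.subtype F.ker_subtype).map' L.symm.toLinearMap L.symm.ker
  · have h : (fun a => chartDeriv x x (frame a)) = F.subtype ∘ b := by
      ext1 a
      rw [← chartEquiv_apply x x (mem_chart_source (Model n) x)]
      exact L.apply_symm_apply _
    change Submodule.span ℝ (Set.range fun a => chartDeriv x x (frame a)) = F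
    rw [h, Set.range_comp, Submodule.span_image, b.span_eq, Submodule.map_top,
      Submodule.range_subtype]

namespace GrChart

variable {k : ℕ} {E : TangentPlane n M} (κ : GrChart k E)

theorem point_center_fst (A : Fin k → κ.compl) : κ.point (κ.center.1, A) = E.1 :=
  (extChartAt (𝓡 n) E.1).left_inv (mem_extChartAt_source E.1)

theorem plane_center_fst (A : Fin k → κ.compl) : κ.plane (κ.center.1, A) =
    ⟨E.1, Submodule.span ℝ (Set.range fun a =>
      chartDeriv E.1 E.1 (κ.frame a + (A a : Model n)))⟩ := by
  -- The base point of the chart plane equals E.1 only propositionally while the tangent space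
  -- depends on it, so it is replaced by a variable before substitution.
  have h : ∀ z, z = E.1 → (⟨z, Submodule.span ℝ (Set.range fun a =>
      chartDeriv E.1 z (κ.frame a + (A a : Model n)))⟩ : TangentPlane n M) =
      ⟨E.1, Submodule.span ℝ (Set.range fun a =>
      chartDeriv E.1 E.1 (κ.frame a + (A a : Model n)))⟩ := by
    rintro _ rfl; rfl
  exact h _ (κ.point_center_fst A)

theorem form_center_fst (ψ : Form n M k) (A : Fin k → κ.compl) :
    ψ (κ.point (κ.center.1, A)) (κ.basis (κ.center.1, A)) =
      ψ E.1 (fun a => chartDeriv E.1 E.1 (κ.frame a + (A a : Model n))) := by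
  have h : ∀ z, z = E.1 → ψ z (fun a => chartDeriv E.1 z (κ.frame a + (A a : Model n))) =
      ψ E.1 (fun a => chartDeriv E.1 E.1 (κ.frame a + (A a : Model n))) := by
    rintro _ rfl; rfl
  exact h _ (κ.point_center_fst A)

theorem linearIndependent_add (A : Fin k → κ.compl) :
    LinearIndependent ℝ fun a => κ.frame a + (A a : Model n) := by
  rw [Fintype.linearIndependent_iff]
  intro c hc
  refine Fintype.linearIndependent_iff.1 κ.linearIndependent c ?_
  simp only [smul_add, Finset.sum_add_distrib] at hc
  have h1 : ∑ a, c a • κ.frame a ∈ Submodule.span ℝ (Set.range κ.frame) :=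
    Submodule.sum_mem _ fun a _ => Submodule.smul_mem _ _ (Submodule.subset_span ⟨a, rfl⟩)
  have h2 : ∑ a, c a • κ.frame a ∈ κ.compl := by
    rw [eq_neg_of_add_eq_zero_left hc]
    exact Submodule.neg_mem _ (Submodule.sum_mem _ fun a _ => Submodule.smul_mem _ _ (A a).2)
  exact (Submodule.mem_bot ℝ).1 (κ.isCompl.inf_eq_bot ▸ Submodule.mem_inf.2 ⟨h1, h2⟩)

/-- The domain of the chart. -/
def domain : Set κ.Coord := Prod.fst ⁻¹' (extChartAt (𝓡 n) E.1).target

theorem isOpen_domain : IsOpen κ.domain :=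
  (isOpen_extChartAt_target E.1).preimage continuous_fst

theorem center_mem_domain : κ.center ∈ κ.domain := mem_extChartAt_target (I := 𝓡 n) E.1

/-- The function on the Grassmann bundle defined by a smooth form is smooth. -/
theorem contDiffOn_form {ψ : Form n M k} (hψ : IsSmoothForm ψ) :
    ContDiffOn ℝ ∞ (fun q : κ.Coord => ψ (κ.point q) (κ.basis q)) κ.domain := by
  let b := EuclideanSpace.basisFun (Fin n) ℝ
  -- In the coordinate frame the function is a polynomial in the fibre coordinates whose
  -- coefficients are smooth functions of the base point.
  have h : ∀ q : κ.Coord, ψ (κ.point q) (κ.basis q) = ∑ I : Fin k → Fin n,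
      (∏ a, (κ.frame a + (q.2 a : Model n)) (I a)) *
        ψ (κ.point q) (fun a => chartDeriv E.1 (κ.point q) (b (I a))) := by
    intro q
    rw [← map_sum_smul (ψ (κ.point q)) (fun i => chartDeriv E.1 (κ.point q) (b i))
      (fun a i => (κ.frame a + (q.2 a : Model n)) i)]
    congr 1
    ext1 a
    simp only [basis, ← map_smul, ← map_sum]
    congr 1
    exact (b.sum_repr _).symm
  simp only [h]
  refine ContDiffOn.sum fun I _ => ContDiffOn.mul ?_ ?_
  · refine ContDiff.contDiffOn (contDiff_prod fun a _ => ?_)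
    have h1 : ContDiff ℝ ∞ fun q : κ.Coord => κ.frame a + (q.2 a : Model n) :=
      contDiff_const.add (κ.compl.subtypeL.contDiff.comp ((contDiff_apply ℝ κ.compl a).comp contDiff_snd))
    exact (EuclideanSpace.proj (𝕜 := ℝ) (I a)).contDiff.comp h1
  · have h2 : ContMDiffOn (𝓡 n) 𝓘(ℝ, ℝ) ∞
        (fun z => ψ z (fun a => chartDeriv E.1 z (b (I a)))) (chartAt (Model n) E.1).source :=
      fun z hz => (hψ z _ fun a => smoothFieldAt_chartDeriv E.1 _ hz).contMDiffWithinAt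
    have h3 := (contMDiffOn_iff_contDiffOn.1 (h2.comp (contMDiffOn_extChartAt_symm (n := ∞) E.1)
      (fun y hy => by simpa using (extChartAt (𝓡 n) E.1).map_target hy)))
    exact h3.comp contDiff_fst.contDiffOn fun q hq => hq

end GrChart

end Manifold

theorem fderiv_apply_eq_of_forall {X Y : Type*} [NormedAddCommGroup X] [NormedSpace ℝ X]
    [NormedAddCommGroup Y] [NormedSpace ℝ Y] {f : X → Y} {q v : X} {y : Y}
    (hf : DifferentiableAt ℝ f q) (h : ∀ t : ℝ, f (q + t • v) = t • y) : fderiv ℝ f q v = y := by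
  have h1 : HasDerivAt (fun t : ℝ => f (q + t • v)) (fderiv ℝ f q v) 0 :=
    hf.hasFDerivAt.hasLineDerivAt v
  simp only [h] at h1
  refine h1.unique ?_
  simpa using (hasDerivAt_id (0 : ℝ)).smul_const y

/-! ### Codimension of the integral elements, and their polar spaces -/

section Manifold

variable {n : ℕ} {M : Type*} [TopologicalSpace M] [ChartedSpace (Model n) M]
  [IsManifold (𝓡 n) ∞ M]

/-- A criterion for the codimension of a set of integral elements: the differentials of the
functions given by the forms `ψ i` are independent on rank one variations of `E`. -/
theorem hasCodimAtLeast_integralElements [Bundle.RiemannianBundle (fun x : M => TangentSpace (𝓡 n) x)]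
    (J : ∀ k : ℕ, Submodule ℝ (Form n M k))
    {p c : ℕ} {E : TangentPlane n M} (hE : E ∈ integralElements J p) {e : Fin p → Tan n E.1}
    (he : Orthonormal ℝ e) (heE : ∀ a, e a ∈ E.2) (ψ : Fin c → Form n M p)
    (hψ : ∀ i, IsSmoothForm (ψ i)) (hψJ : ∀ i, ψ i ∈ J p) (b : Fin c → Fin p)
    (w : Fin c → Tan n E.1) (hw : ∀ i a, inner ℝ (w i) (e a) = 0) {r : ℝ} (hr : r ≠ 0)
    (hψw : ∀ i j, ψ i E.1 (Function.update e (b j) (w j)) = if i = j then r else 0) :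
    HasCodimAtLeast p (integralElements J p) E c := by
  let L := chartEquiv E.1 E.1 (mem_chart_source (Model n) E.1)
  have hL : ∀ v, chartDeriv E.1 E.1 v = L v := fun v => (chartEquiv_apply _ _ _ v).symm
  set K := Submodule.span ℝ (Set.range e) with hK
  have hKE : K = E.2 := by
    refine Submodule.eq_of_le_of_finrank_eq (Submodule.span_le.2 ?_) ?_
    · rintro _ ⟨a, rfl⟩; exact heE a
    · rw [hE.1, finrank_span_eq_card he.linearIndependent, Fintype.card_fin]
  have hspan : Submodule.span ℝ (Set.range fun a => L.symm (e a)) =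
      Submodule.map L.symm.toLinearMap K := by
    rw [hK, Submodule.map_span, ← Set.range_comp]
    rfl
  -- With the orthonormal frame of E and its orthogonal complement, replacing e (b j) by e (b j) + t
  -- w j is a straight line in the chart.
  let κ : GrChart p E :=
    { frame := fun a => L.symm (e a)
      compl := Submodule.map L.symm.toLinearMap Kᗮ
      linearIndependent := he.linearIndependent.map' L.symm.toLinearMap L.symm.ker
      span_eq := by simp only [hL, L.apply_symm_apply]; exact hKE
      isCompl := by
        rw [hspan]
        exact (Submodule.orderIsoMapComap L.symm).isCompl K.isCompl_orthogonal }
  let f : κ.Coord → Fin c → ℝ := fun q i => ψ i (κ.point q) (κ.basis q)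
  have hf : ContDiffOn ℝ ∞ f κ.domain := contDiffOn_pi.2 fun i => κ.contDiffOn_form (hψ i)
  have hU : κ.domain ∈ 𝓝 κ.center := κ.isOpen_domain.mem_nhds κ.center_mem_domain
  have hfc : ∀ A, f (κ.center.1, A) =
      fun i => ψ i E.1 (fun a => e a + L (A a : Model n)) := by
    intro A
    ext i
    refine (κ.form_center_fst (ψ i) A).trans ?_
    congr 1
    ext1 a
    rw [map_add, hL, hL]
    change L (L.symm (e a)) + _ = _
    rw [L.apply_symm_apply]
  have hψ0 : ∀ i, ψ i E.1 e = 0 := fun i => hE.2 p (ψ i) (hψJ i) e heE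
  have hwK : ∀ j, w j ∈ Kᗮ := by
    intro j
    rw [Submodule.mem_orthogonal']
    intro u hu
    induction hu using Submodule.span_induction with
    | mem u hu => obtain ⟨a, rfl⟩ := hu; exact hw j a
    | zero => simp
    | add u v _ _ hu hv => rw [inner_add_right, hu, hv, add_zero]
    | smul t u _ hu => rw [real_inner_smul_right, hu, mul_zero]
  let v : Fin c → κ.Coord := fun j =>
    (0, Function.update 0 (b j) ⟨L.symm (w j), Submodule.mem_map_of_mem (hwK j)⟩)
  -- Only one slot varies and the forms vanish on E, so f is exactly linear along this line and its
  -- derivative can be read off.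
  have hline : ∀ j (t : ℝ), f (κ.center + t • v j) = t • (r • Pi.single j 1) := by
    intro j t
    have h1 : κ.center + t • v j = (κ.center.1, (t • v j).2) := by
      ext1
      · simp [v]
      · simp [GrChart.center]
    rw [h1, hfc]
    ext i
    have h2 : (fun a => e a + L (((t • v j).2 a : κ.compl) : Model n)) =
        Function.update e (b j) (e (b j) + t • w j) := by
      ext1 a
      by_cases ha : a = b j
      · subst ha; simp [v]
      · simp [v, ha]
    rw [h2, AlternatingMap.map_update_add, AlternatingMap.map_update_smul, Function.update_eq_self,
      hψ0, zero_add, hψw]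
    simp [Pi.single_apply]
  have hv : ∀ j, fderiv ℝ f κ.center (v j) = r • Pi.single j 1 := fun j =>
    fderiv_apply_eq_of_forall ((hf.contDiffAt hU).differentiableAt (by simp)) (hline j)
  refine ⟨κ, κ.domain, f, hU, hf, ?_, ?_, ?_⟩
  · refine (hfc 0).trans (funext fun i => ?_)
    simp [hψ0]
  · intro y
    refine ⟨∑ j, (y j / r) • v j, ?_⟩
    rw [map_sum]
    simp only [map_smul, hv, smul_smul, div_mul_cancel₀ _ hr]
    ext i
    simp [Finset.sum_apply, Pi.single_apply]
  · intro q _ hq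
    ext i
    exact hq.2 p (ψ i) (hψJ i) (κ.basis q) fun a =>
      Submodule.subset_span (M := Tan n (κ.point q)) (Set.mem_range_self a)

omit [IsManifold (𝓡 n) ∞ M] in
/-- An integral element lies in the polar spaces of its hyperplanes. -/
theorem le_polarSpace {J : ∀ k : ℕ, Submodule ℝ (Form n M k)} {m : ℕ} {E : TangentPlane n M}
    (hE : E ∈ integralElements J (m + 1)) {F : Submodule ℝ (Tan n E.1)} (hF : F ≤ E.2) :
    E.2 ≤ polarSpace J m ⟨E.1, F⟩ := fun _ hv ψ hψ _ he =>
  hE.2 _ ψ hψ _ fun i => Fin.cases hv (fun j => hF (he j)) i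

variable [Bundle.RiemannianBundle (fun x : M => TangentSpace (𝓡 n) x)]

theorem criticalIdeal_eq_bot {p k : ℕ} (φ : Form n M p) (hk : k < p) : criticalIdeal φ k = ⊥ :=
  idealGeneratedBy_eq_bot _ hk

theorem mem_integralElements_of_lt {p k : ℕ} (φ : Form n M p) (hk : k < p) (x : M)
    {F : Submodule ℝ (Tan n x)} (hF : Module.finrank ℝ F = k) :
    (⟨x, F⟩ : TangentPlane n M) ∈ integralElements (criticalIdeal φ) k := by
  refine ⟨hF, fun j ψ hψ v hv => ?_⟩
  rcases lt_or_ge j p with hj | hj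
  · rw [criticalIdeal_eq_bot φ hj, Submodule.mem_bot] at hψ
    rw [hψ]; rfl
  -- A form of degree at least p > dim F vanishes on F because its arguments are dependent.
  · refine (ψ x).map_linearDependent v fun hli => ?_
    have h1 : LinearIndependent ℝ (fun i => (⟨v i, hv i⟩ : F)) :=
      LinearIndependent.of_comp F.subtype hli
    have h2 := h1.fintype_card_le_finrank
    rw [Fintype.card_fin, hF] at h2
    omega

/-- In degrees below that of the generators all planes are Kähler-ordinary. -/
theorem isKahlerOrdinary_of_lt {p k : ℕ} (φ : Form n M p) (hk : k < p) (x : M)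
    {F : Submodule ℝ (Tan n x)} (hF : Module.finrank ℝ F = k) :
    IsKahlerOrdinary (criticalIdeal φ) k (⟨x, F⟩ : TangentPlane n M) := by
  obtain ⟨κ⟩ := nonempty_grChart x F hF
  refine ⟨mem_integralElements_of_lt φ hk x hF, κ, 0, Fin.elim0, fun i => i.elim0,
    linearIndependent_empty_type, Filter.Eventually.of_forall fun q _ χ hχ => ?_⟩
  rw [criticalIdeal_eq_bot φ hk, Submodule.mem_bot] at hχ
  rw [hχ]; rfl

theorem polarSpace_eq_top {p k : ℕ} (φ : Form n M p) (hk : k + 1 < p) (E : TangentPlane n M) :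
    polarSpace (criticalIdeal φ) k E = ⊤ := by
  refine eq_top_iff.2 fun v _ ψ hψ e _ => ?_
  rw [criticalIdeal_eq_bot φ hk, Submodule.mem_bot] at hψ
  rw [hψ]; rfl

variable [T2Space M]
  [IsContMDiffRiemannianBundle (𝓡 n) ∞ (Model n) (fun x : M => TangentSpace (𝓡 n) x)]

theorem skewForm_eq_zero_of_mem_polarSpace {m : ℕ} {φ : Form n M (m + 1)} (hφ : IsSmoothForm φ)
    {x : M} {F : Submodule ℝ (Tan n x)} {v : Tan n x}
    (hv : v ∈ polarSpace (criticalIdeal φ) m ⟨x, F⟩) {f : Fin m → Tan n x} (hf : ∀ i, f i ∈ F)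
    (a b : Tan n x) : skewForm (φ x) a b (Matrix.vecCons v f) = 0 := by
  obtain ⟨ψ, hψ, hψx⟩ := exists_mem_criticalSystem hφ x a b
  rw [← hψx]
  exact hv ψ (mem_idealGeneratedBy hψ) f hf

/-- The polar space of a hyperplane of an integral element with nonzero critical value. -/
theorem polarSpace_eq {m : ℕ} {φ : Form n M (m + 1)} (hφ : IsSmoothForm φ)
    {E : TangentPlane n M} (hE : E ∈ integralElements (criticalIdeal φ) (m + 1))
    {e : Fin (m + 1) → Tan n E.1} (heE : ∀ a, e a ∈ E.2) (he0 : φ E.1 e ≠ 0)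
    {F : Submodule ℝ (Tan n E.1)} (hF : F ≤ E.2) (hFm : Module.finrank ℝ F = m) :
    polarSpace (criticalIdeal φ) m ⟨E.1, F⟩ = E.2 := by
  refine le_antisymm (fun v hv => ?_) (le_polarSpace hE hF)
  have hdec := E.2.starProjection_add_starProjection_orthogonal v
  set u := E.2.starProjection v
  set w := E.2ᗮ.starProjection v with hw
  have huE : u ∈ E.2 := Submodule.starProjection_apply_mem _ _
  have hwE : w ∈ E.2ᗮ := Submodule.starProjection_apply_mem _ _
  have hwH : w ∈ polarSpace (criticalIdeal φ) m ⟨E.1, F⟩ := by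
    -- The normal part w = v - u is again polar, because E lies in the polar space.
    rw [← eq_sub_iff_add_eq'] at hdec
    rw [hdec]
    exact Submodule.sub_mem _ hv (le_polarSpace hE hF huE)
  obtain ⟨y, hyE, hyF⟩ : ∃ y ∈ E.2, y ∉ F := by
    by_contra! h
    have := Submodule.finrank_mono (show E.2 ≤ F from h)
    rw [hE.1, hFm] at this
    omega
  let e₀ := y - F.starProjection y
  have hproj : F.starProjection y ∈ F := Submodule.starProjection_apply_mem _ _
  have he₀E : e₀ ∈ E.2 := Submodule.sub_mem _ hyE (hF hproj)
  have he₀F : e₀ ∉ F := fun h => hyF (by simpa [e₀] using F.add_mem h hproj)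
  have he₀o : ∀ z ∈ F, inner ℝ e₀ z = 0 := fun z hz =>
    Submodule.inner_left_of_mem_orthogonal hz (Submodule.sub_starProjection_mem_orthogonal y)
  let bF := (Module.finBasis ℝ F).reindex (finCongr hFm)
  let f : Fin m → Tan n E.1 := fun i => bF i
  have hfF : ∀ i, f i ∈ F := fun i => (bF i).2
  have hspan : Submodule.span ℝ (Set.range f) = F := by
    have : f = F.subtype ∘ bF := rfl
    rw [this, Set.range_comp, Submodule.span_image, bF.span_eq, Submodule.map_top,
      Submodule.range_subtype]
  have hli : LinearIndependent ℝ (Matrix.vecCons e₀ f) :=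
    linearIndependent_finCons.2 ⟨bF.linearIndependent.map' F.subtype F.ker_subtype,
      by rwa [hspan]⟩
  have hmem : ∀ i, Matrix.vecCons e₀ f i ∈ E.2 := fun i =>
    Fin.cases he₀E (fun j => hF (hfF j)) i
  -- On E the form has top degree and is nonzero, so it is nonzero on every basis; neither e₀ nor f
  -- has to be normalized.
  have hne : φ E.1 (Matrix.vecCons e₀ f) ≠ 0 := by
    have hliE : LinearIndependent ℝ (fun i => (⟨Matrix.vecCons e₀ f i, hmem i⟩ : E.2)) :=
      LinearIndependent.of_comp E.2.subtype hli
    let bE := basisOfLinearIndependentOfCardEqFinrank hliE (by rw [hE.1, Fintype.card_fin])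
    have h1 : (φ E.1).compLinearMap E.2.subtype ≠ 0 := fun h =>
      he0 (congrArg (fun g => g (fun a => (⟨e a, heE a⟩ : E.2))) h)
    have h2 := (AlternatingMap.map_basis_ne_zero_iff bE _).2 h1
    simpa [bE] using h2
  -- The rotation `skewMap w e₀` kills F and sends w to |w|² e₀, so the vanishing value is |w|²
  -- φ(e₀, f), and w must be zero.
  have h0 := skewForm_eq_zero_of_mem_polarSpace hφ hwH hfF w e₀
  rw [skewForm, derivationForm_apply_of_forall_ne _ _ _ 0] at h0
  · have h3 : skewMap w e₀ (Matrix.vecCons w f 0) = inner ℝ w w • e₀ := by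
      rw [skewMap_apply, Matrix.cons_val_zero, Submodule.inner_right_of_mem_orthogonal he₀E hwE,
        zero_smul, sub_zero]
    have h4 : Function.update (Matrix.vecCons w f) 0 (inner ℝ w w • e₀) =
        Function.update (Matrix.vecCons e₀ f) 0 (inner ℝ w w • e₀) := by
      ext1 i
      refine Fin.cases ?_ (fun j => ?_) i <;> simp
    rw [h3, h4, AlternatingMap.map_update_smul] at h0
    have h5 : Function.update (Matrix.vecCons e₀ f) 0 e₀ = Matrix.vecCons e₀ f :=
      Function.update_eq_self 0 _
    rw [h5, smul_eq_mul] at h0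
    have hw0 : w = 0 := inner_self_eq_zero.1 ((mul_eq_zero.1 h0).resolve_right hne)
    rw [← hdec, hw0, add_zero]
    exact huE
  · intro i hi
    obtain ⟨j, rfl⟩ := Fin.exists_succ_eq.2 hi
    rw [Matrix.cons_val_succ, skewMap_apply, he₀o _ (hfF j),
      Submodule.inner_left_of_mem_orthogonal (hF (hfF j)) hwE, zero_smul, zero_smul, sub_zero]

/-- Only the hyperplane term k = m contributes, since the ideal is zero in degrees k + 1 < m + 1;
there the polar space is E itself. -/
theorem sum_codim_polarSpace {m : ℕ} {φ : Form n M (m + 1)} (hφ : IsSmoothForm φ)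
    {E : TangentPlane n M} (hE : E ∈ integralElements (criticalIdeal φ) (m + 1))
    {e : Fin (m + 1) → Tan n E.1} (heE : ∀ a, e a ∈ E.2) (he0 : φ E.1 e ≠ 0)
    {F : ℕ → Submodule ℝ (Tan n E.1)} (hF : IsFlag (m + 1) E F) :
    ∑ k ∈ Finset.range (m + 1),
      (n - Module.finrank ℝ (polarSpace (criticalIdeal φ) k ⟨E.1, F k⟩)) = n - (m + 1) := by
  rw [Finset.sum_range_succ, Finset.sum_eq_zero, zero_add,
    polarSpace_eq hφ hE heE he0 (hF.top_eq ▸ hF.le_succ m (by omega)) (hF.finrank_eq m (by omega)),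
    hE.1]
  intro k hk
  rw [polarSpace_eq_top φ (by have := Finset.mem_range.1 hk; omega), finrank_top, finrank_tan,
    Nat.sub_self]

/-- At points where `φ` does not vanish, a Kähler-regular hyperplane has a polar space of dimension
less than `p`. -/
theorem IsKahlerRegular.finrank_polarSpace_lt {m : ℕ} {φ : Form n M (m + 1)} (hφ : IsSmoothForm φ)
    (h1 : m + 1 < n) (h2 : n < 2 * (m + 1)) {x : M} (hx : φ x ≠ 0) {F : Submodule ℝ (Tan n x)}
    (hF : IsKahlerRegular (criticalIdeal φ) m ⟨x, F⟩) :
    Module.finrank ℝ (polarSpace (criticalIdeal φ) m ⟨x, F⟩) < m + 1 := by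
  by_contra! hdim
  obtain ⟨-, κ, hκ⟩ := hF
  let L := chartEquiv x x (mem_chart_source (Model n) x)
  have hL : ∀ v, chartDeriv x x v = L v := fun v => (chartEquiv_apply _ _ _ v).symm
  obtain ⟨a, b, v, f, hdet⟩ := exists_det_skewMatrix_ne_zero (φ x) hx
    (by rwa [finrank_tan]) (by rwa [finrank_tan])
  -- The line of frames runs from a frame of F at t = 0 to the frame f with nonzero determinant at t
  -- = 1.
  let g : Fin m → Model n := fun c => L.symm (f c) - κ.frame c
  let D : ℝ → ℝ := fun t => (skewMatrix (φ x) a b v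
    (fun c => L (κ.frame c) + t • L (g c))).det
  have hD : AnalyticOnNhd ℝ D Set.univ := analytic_det_skewMatrix _ _ _ _ _ _
  have hD1 : D 1 ≠ 0 := by
    have : (fun c => L (κ.frame c) + (1 : ℝ) • L (g c)) = f := by
      ext1 c
      simp [g]
    simpa only [D, this] using hdet
  -- By the identity theorem it suffices that D vanishes near 0. If D t ≠ 0 for a plane near F, its
  -- polar space has codimension at least n - (m + 1) + 1, hence dimension at most m; but that plane
  -- is Kähler-ordinary, so regularity gives it the same polar dimension as F, which is at least m +
  -- 1.
  refine hD1 (hD.eqOn_zero_of_preconnected_of_eventuallyEq_zero isPreconnected_univ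
    (Set.mem_univ 0) ?_ (Set.mem_univ 1))
  have hcont : Continuous fun A : Fin m → κ.compl => ((κ.center.1, A) : κ.Coord) := by fun_prop
  have hN := hcont.continuousAt.preimage_mem_nhds (x := (0 : Fin m → κ.compl)) hκ
  filter_upwards [eventually_exists_span_eq κ.frame κ.compl κ.isCompl g hN] with t ⟨A, hA, hspan⟩
  by_contra hDt
  change ¬ D t = 0 at hDt
  have hplane := κ.plane_center_fst A
  set F' : Submodule ℝ (Tan n x) := Submodule.span ℝ (Set.range fun c =>
    chartDeriv x x (κ.frame c + (A c : Model n))) with hF'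
  have hF'm : Module.finrank ℝ F' = m := by
    rw [finrank_span_eq_card (linearIndependent_chartDeriv (mem_chart_source _ x)
      (κ.linearIndependent_add A)), Fintype.card_fin]
  have hspan' : F' = Submodule.map L.toLinearMap
      (Submodule.span ℝ (Set.range fun c => κ.frame c + t • g c)) := by
    rw [← hspan, Submodule.map_span, ← Set.range_comp, hF']
    simp only [hL]
    rfl
  have hA' : IsKahlerOrdinary (criticalIdeal φ) m (κ.plane (κ.center.1, A)) →
    Module.finrank ℝ (polarSpace (criticalIdeal φ) m (κ.plane (κ.center.1, A))) =
      Module.finrank ℝ (polarSpace (criticalIdeal φ) m ⟨x, F⟩) := hA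
  rw [hplane] at hA'
  have hfin := hA' (isKahlerOrdinary_of_lt φ (Nat.lt_succ_self m) x hF'm)
  have hle := finrank_add_le_of_det_skewMatrix_ne_zero _ _ _ _ _ hDt
    (polarSpace (criticalIdeal φ) m ⟨x, F'⟩) fun u hu i =>
      skewForm_eq_zero_of_mem_polarSpace hφ hu (fun c => by
          rw [hspan']
          exact ⟨κ.frame c + t • g c, Submodule.subset_span ⟨c, rfl⟩, by simp⟩) (a i) (b i)
  rw [finrank_tan, Fintype.card_sum, Fintype.card_fin, Fintype.card_unit] at hle
  have hle' : Module.finrank ℝ (polarSpace (criticalIdeal φ) m ⟨x, F⟩) + (n - (m + 1) + 1) ≤ n :=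
    hfin ▸ hle
  omega

end Manifold

end EDS

end

/-! ### The main theorem -/

theorem mainTheorem9 (n p : ℕ) (hp : 1 ≤ p)
    (M : Type*) [TopologicalSpace M] [T2Space M] [ConnectedSpace M]
    [ChartedSpace (EDS.Model n) M] [IsManifold (𝓡 n) ∞ M]
    [Bundle.RiemannianBundle (fun x : M => TangentSpace (𝓡 n) x)]
    [IsContMDiffRiemannianBundle (𝓡 n) ∞ (EDS.Model n) (fun x : M => TangentSpace (𝓡 n) x)]
    (φ : EDS.Form n M p) (hφ : EDS.IsParallelCalibration φ) (hφ0 : φ ≠ 0) :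
    (∀ E ∈ EDS.integralElements (EDS.criticalIdeal φ) p,
      ∀ e : Fin p → EDS.Tan n E.1, Orthonormal ℝ e → (∀ a, e a ∈ E.2) → φ E.1 e ≠ 0 →
        (∀ F, EDS.IsFlag p E F →
          ∑ k ∈ Finset.range p,
            (n - Module.finrank ℝ (EDS.polarSpace (EDS.criticalIdeal φ) k ⟨E.1, F k⟩)) = n - p) ∧
        EDS.HasCodimAtLeast p (EDS.integralElements (EDS.criticalIdeal φ) p) E (n - p) ∧
        (p < n →
          EDS.HasCodimAtLeast p (EDS.integralElements (EDS.criticalIdeal φ) p) E p)) ∧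
    (n < 2 * p → p < n → ∀ x : M, ¬ EDS.IsInvolutiveAt (EDS.criticalIdeal φ) p x) := by
  obtain ⟨m, rfl⟩ : ∃ m, p = m + 1 := ⟨p - 1, by omega⟩
  refine ⟨fun E hE e he heE he0 => ⟨fun F hF => EDS.sum_codim_polarSpace hφ.smooth hE heE he0 hF,
    ?_⟩, fun h2 h1 x ⟨E, hE, F, hF, hreg⟩ => ?_⟩
  · obtain ⟨w, hw, hwe⟩ := EDS.exists_orthonormal_compl he
    have hdim : Module.finrank ℝ (EDS.Tan n E.1) = n := EDS.finrank_tan E.1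
    -- This identifies the index type of the normal frame w with `Fin (n - p)`.
    generalize Module.finrank ℝ (EDS.Tan n E.1) = d at w hdim
    subst hdim
    constructor
    -- For codimension n - p the slot 0 is fixed and the normal direction varies.
    · choose ψ hψ hψx using fun i => EDS.exists_mem_criticalSystem hφ.smooth E.1 (w i) (e 0)
      refine EDS.hasCodimAtLeast_integralElements _ hE he heE ψ (fun i => (hψ i).1)
        (fun i => EDS.mem_idealGeneratedBy (hψ i)) (fun _ => 0) w hwe he0 fun i j => ?_
      rw [hψx, EDS.skewForm_update_self _ he 0 (hwe i) (hwe j), orthonormal_iff_ite.1 hw i j]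
      simp
    · intro hpn
      let i₀ : Fin (d - (m + 1)) := ⟨0, by omega⟩
      -- For codimension p one normal direction is fixed, which exists since p < n, and the slot
      -- varies.
      choose ψ hψ hψx using fun a => EDS.exists_mem_criticalSystem hφ.smooth E.1 (w i₀) (e a)
      refine EDS.hasCodimAtLeast_integralElements _ hE he heE ψ (fun i => (hψ i).1)
        (fun i => EDS.mem_idealGeneratedBy (hψ i)) id (fun _ => w i₀) (fun _ => hwe i₀) he0
        fun i j => ?_
      rw [hψx, id]
      split_ifs with hij
      · subst hij
        rw [EDS.skewForm_update_self _ he i (hwe i₀) (hwe i₀), orthonormal_iff_ite.1 hw i₀ i₀]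
        simp
      · exact EDS.skewForm_update_of_ne _ he (Ne.symm hij) (hwe i₀)
  -- The last hyperplane of the flag has a polar space of dimension less than p by regularity, yet
  -- this space contains the p-dimensional E.
  · have h3 := (hreg m (Nat.lt_succ_self m)).finrank_polarSpace_lt hφ.smooth h1 h2
      (hφ.parallel.ne_zero hφ.smooth hφ0 x)
    have h4 := Submodule.finrank_mono (EDS.le_polarSpace (F := F m) hE
      ((hF.le_succ m (Nat.lt_succ_self m)).trans hF.top_eq.le))
    rw [hE.1] at h4
    exact absurd h3 (not_lt.2 h4)
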